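/- **Setting.** Let $\mathbb X$ be a virtual equipment: a virtual double category with all loose-identities and all restrictions, a choice of which is fixed (if $\mathbb X$ is strict, the strictly functorial choice is allowed; strictness is not needed). A loose-cell from $X$ to $Y$ is written $p : X \nrightarrow Y$. Write $q(f,g)$ for the restriction of $q$ along $f$ (on the codomain side) and $g$ (on the domain side), $A(1,1)$ for the loose-identity of $A$, $X(f,g) := X(1,1)(f,g)$, and $E(j,1) : E \nrightarrow A$ for the conjoint of a tight-cell $j : A \to E$. A *weight* $\vec p : Y \nrightarrow \cdots \nrightarrow Z$ is a finite chain $(p_1,\dots,p_m)$ of loose-cells, $m \ge 0$, where $p_1$ has codomain $Z$ and $p_m$ has domain $Y$. **Lifts.** For $q : X \nrightarrow Z$ and a weight $\vec p : Y \nrightarrow \cdots\nrightarrow Z$, a *right lift* of $q$ through $\vec p$ is a loose-cell $q\blacktriangleleft\vec p : X \nrightarrow Y$ with a globular 2-cell $\varpi : \vec p,\, q\blacktriangleleft\vec p \Rightarrow q$ through which every globular 2-cell $\vec p, r_1,\dots,r_n \Rightarrow q$ ($n\ge 0$) factors uniquely, by a 2-cell $r_1,\dots,r_n\Rightarrow q\blacktriangleleft\vec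 p$. The weight $\vec p$ is *lifting* if all right lifts through it exist. **Colimits.** A $\vec p$-cocone for $f : Z \to X$ is a tight-cell $c : Y\to X$ with a 2-cell $\gamma : \vec p \Rightarrow X(f,c)$; it is a $\vec p$-*colimit* if the induced 2-cell $\vec p, X(c,1) \Rightarrow X(f,1)$ exhibits $X(c,1)$ as the right lift of $X(f,1)$ through $\vec p$. A tight-cell $g : X\to X'$ *preserves* the colimit if the induced cocone $(gc, \vec p\Rightarrow X'(gf,gc))$ is a colimit of $gf$. A loose-cell $p : W \nrightarrow X$ *respects* it if the canonical 2-cell $\vec p, p(c,1)\Rightarrow p(f,1)$ exhibits $p(c,1)$ as the right lift of $p(f,1)$ through $\vec p$. A *left extension* of $f : A \to X$ along $j : A \to E$ is an $E(j,1)$-weighted colimit of $f$. **Classes of weights.** Let $\Phi$ be a class of weights. An object is *$\Phi$-cocomplete* if every tight-cell into it has all colimits weighted by (composable) members of $\Phi$. A tight-cell with $\Phi$-cocomplete domain is *$\Phi$-cocontinuous* if it preserves every colimit weighted by a member of $\Phi$; a loose-cell with $\Phi$-cocomplete codomain is *$\Phi$-exact* if it respects every such colimit. Write $\Phi \lesssim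 \Phi'$ if every $\Phi'$-cocomplete object is $\Phi$-cocomplete, every $\Phi'$-cocontinuous tight-cell is $\Phi$-cocontinuous, and every $\Phi'$-exact loose-cell is $\Phi$-exact. The *colimit saturation* of $\Phi$ is the largest class $\Phi'$ of weights with $\Phi\lesssim\Phi'$ and $\Phi'\lesssim\Phi$. **Cocompletions.** A tight-cell $j : A \to E$ *exhibits the $\Phi$-cocompletion of $A$* if: * $E$ is $\Phi$-cocomplete; * for each tight-cell $f : A \to X$ with $X$ $\Phi$-cocomplete, a left extension $c : E\to X$ of $f$ along $j$ exists, its unit $f \Rightarrow cj$ is invertible, and $c$ is, up to isomorphism, the unique $\Phi$-cocontinuous tight-cell $\tilde f : E \to X$ such that $f\cong \tilde f j$; * for each loose-cell $p : X \nrightarrow A$, the right lift $p\blacktriangleleft E(j,1)$ exists, the canonical 2-cell $(p\blacktriangleleft E(j,1))(j,1)\Rightarrow p$ is invertible, and $p\blacktriangleleft E(j,1)$ is, up to isomorphism, the unique $\Phi$-exact loose-cell $\tilde p : X \nrightarrow E$ such that $p\cong\tilde p(j,1)$. The tight-cell $j$ is *dense* if the 2-cell $E(j,1),E(1,1)\Rightarrow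 E(j,1)$ corresponding to the identity exhibits $E(1,1)$ as the right lift of $E(j,1)$ through $E(j,1)$, and *fully faithful* if the canonical 2-cell $A(1,1)\Rightarrow E(j,j)$ is invertible. **Theorem.** Let $\Phi$ be a class of weights in $\mathbb X$. A tight-cell $j : A \to E$ exhibits the $\Phi$-cocompletion of $A$ if and only if 1. $E$ is $\Phi$-cocomplete; 2. $E(j,1)$ (as a unary weight) is in the colimit saturation of $\Phi$; 3. $E(j,1)$ is lifting, and right lifts through $E(j,1)$ are $\Phi$-exact; 4. $j$ is dense and fully faithful. -/

import Mathlib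

open CategoryTheory

universe u v w z

namespace VDC

/-! Chains of loose-cells. For `L X Y` the type of loose-cells `X ⇸ Y`, a term of
`LooseChain L X Y` is a chain `(p₁, …, pₘ) : X ⇸ ⋯ ⇸ Y` with `m ≥ 0`, where `p₁` has codomain `Y`
and `pₘ` has domain `X`, so that chains read in the nondiagrammatic order. -/

inductive LooseChain {V : Type u} (L : V → V → Type w) (X : V) : V → Type (max u w)
  | nil : LooseChain L X X
  | cons {Y Z : V} (p : L Y Z) (ps : LooseChain L X Y) : LooseChain L X Z

namespace LooseChain

variable {V : Type u} {L : V → V → Type w}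

/-- The concatenated chain `(p₁, …, pₘ, q₁, …, qₙ)`. -/
def append {X Y Z : V} : LooseChain L Y Z → LooseChain L X Y → LooseChain L X Z
  | nil, qs => qs
  | cons p ps, qs => cons p (append ps qs)

/-- The chain with the single member `p`. -/
def single {X Y : V} (p : L X Y) : LooseChain L X Y := cons p nil

theorem append_nil {X Y : V} (ps : LooseChain L X Y) : ps.append nil = ps := by
  induction ps with
  | nil => rfl
  | cons p ps ih => simp [append, ih]

theorem append_assoc {W X Y Z : V} (ps : LooseChain L Y Z) (qs : LooseChain L X Y)
    (rs : LooseChain L W X) : (ps.append qs).append rs = ps.append (qs.append rs) := by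
  induction ps with
  | nil => rfl
  | cons p ps ih => simp [append, ih]

end LooseChain

/-- A juxtaposable row of 2-cells. Given a family `C` of 2-cells, where `C f ps g q` is the type of
2-cells with left side `f`, top `ps`, right side `g` and bottom `q`, a term of
`CellChain C f ps g qs` is a row `φ₁, …, φₙ` (`n ≥ 0`) in which the right side of `φᵢ` is the left
side of `φᵢ₊₁`; `ps` is the concatenation of the tops and `qs` is the chain of the bottoms. An empty
row consists of one tight-cell. -/
inductive CellChain {V : Type u} [Category.{v} V] {L : V → V → Type w}
    (C : ∀ ⦃A A' B B' : V⦄, (A ⟶ B) → LooseChain L A' A → (A' ⟶ B') → L B' B → Type z) :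
    ∀ {A A' B B' : V}, (A ⟶ B) → LooseChain L A' A → (A' ⟶ B') → LooseChain L B' B →
      Type (max u v w z)
  | nil {A B : V} (f : A ⟶ B) : CellChain C f (.nil : LooseChain L A A) f (.nil : LooseChain L B B)
  | cons {A A' A'' B B' B'' : V} {f : A ⟶ B} {g : A' ⟶ B'} {h : A'' ⟶ B''}
      {ps : LooseChain L A' A} {ps' : LooseChain L A'' A'} {ts : LooseChain L A'' A}
      {q : L B' B} {qs : LooseChain L B'' B'}
      (e : ts = ps.append ps') (φ : C f ps g q) (φs : CellChain C g ps' h qs) :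
      CellChain C f ts h (.cons q qs)

namespace CellChain

variable {V : Type u} [Category.{v} V] {L : V → V → Type w}
  {C : ∀ ⦃A A' B B' : V⦄, (A ⟶ B) → LooseChain L A' A → (A' ⟶ B') → L B' B → Type z}

/-- Juxtaposition of two rows. -/
def append {A A' A'' B B' B'' : V} {f : A ⟶ B} {g : A' ⟶ B'} {h : A'' ⟶ B''}
    {ps : LooseChain L A' A} {qs : LooseChain L B' B}
    {ps' : LooseChain L A'' A'} {qs' : LooseChain L B'' B'} :
    CellChain C f ps g qs → CellChain C g ps' h qs' →
      CellChain C f (ps.append ps') h (qs.append qs')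
  | .nil f, θ => θ
  | .cons e φ φs, θ => .cons (by rw [e, LooseChain.append_assoc]) φ (append φs θ)

/-- The row with the single member `φ`. -/
def single {A A' B B' : V} {f : A ⟶ B} {ps : LooseChain L A' A} {g : A' ⟶ B'} {q : L B' B}
    (φ : C f ps g q) : CellChain C f ps g (.single q) :=
  .cons (LooseChain.append_nil ps).symm φ (.nil g)

/-- The row with the two members `φ`, `ψ`. -/
def pair {A A' A'' B B' B'' : V} {f : A ⟶ B} {g : A' ⟶ B'} {h : A'' ⟶ B''}
    {ps : LooseChain L A' A} {ps' : LooseChain L A'' A'} {q : L B' B} {q' : L B'' B'}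
    (φ : C f ps g q) (ψ : C g ps' h q') :
    CellChain C f (ps.append ps') h (.cons q (.single q')) :=
  .cons rfl φ (single ψ)

/-- The row of the identity 2-cells on the members of a chain. -/
def ids (one : ∀ ⦃A B : V⦄ (p : L A B), C (𝟙 B) (.single p) (𝟙 A) p) {A B : V} :
    (ps : LooseChain L A B) → CellChain C (𝟙 B) ps (𝟙 A) ps
  | .nil => .nil (𝟙 A)
  | .cons p ps => .cons rfl (one p) (ids one ps)

/-- `Paste comp Θ Φ Ξ` says that the row `Ξ` is obtained by stacking the row `Θ` on top of the row
`Φ`: each member `φ` of `Φ` is composed, by means of `comp`, with the consecutive members of `Θ`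
whose bottoms form the top of `φ`. -/
inductive Paste
    (comp : ∀ ⦃A A' B B' D D' : V⦄ ⦃f : A ⟶ B⦄ ⦃ps : LooseChain L A' A⦄ ⦃g : A' ⟶ B'⦄
      ⦃qs : LooseChain L B' B⦄ ⦃f' : B ⟶ D⦄ ⦃g' : B' ⟶ D'⦄ ⦃s : L D' D⦄,
      CellChain C f ps g qs → C f' qs g' s → C (f ≫ f') ps (g ≫ g') s) :
    ∀ {A A' B B' D D' : V} {f : A ⟶ B} {ps : LooseChain L A' A} {g : A' ⟶ B'}
      {qs : LooseChain L B' B} {f' : B ⟶ D} {g' : B' ⟶ D'} {ss : LooseChain L D' D},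
      CellChain C f ps g qs → CellChain C f' qs g' ss →
        CellChain C (f ≫ f') ps (g ≫ g') ss → Prop
  | nil {A B D : V} (f : A ⟶ B) (f' : B ⟶ D) :
      Paste comp (.nil f) (.nil f') (.nil (f ≫ f'))
  | cons {A A' A'' B B' B'' D D' D'' : V} {f : A ⟶ B} {g : A' ⟶ B'} {h : A'' ⟶ B''}
      {f' : B ⟶ D} {g' : B' ⟶ D'} {h' : B'' ⟶ D''}
      {ps : LooseChain L A' A} {qs : LooseChain L B' B} {s : L D' D}
      {ps' : LooseChain L A'' A'} {qs' : LooseChain L B'' B'} {ss : LooseChain L D'' D'}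
      (θ : CellChain C f ps g qs) (φ : C f' qs g' s)
      {Θ : CellChain C g ps' h qs'} {Φ : CellChain C g' qs' h' ss}
      {Ξ : CellChain C (g ≫ g') ps' (h ≫ h') ss} (H : Paste comp Θ Φ Ξ) :
      Paste comp (θ.append Θ) (.cons rfl φ Φ) (.cons rfl (comp θ φ) Ξ)

end CellChain

/-- A virtual double category, with `V` its type of objects. The category structure is that of
objects and tight-cells; `Loose A B` is the type of loose-cells `A ⇸ B`; `Cell f ps g q` is the type
of 2-cells with the frame given by left side `f`, top `ps`, right side `g` and bottom `q`. The
composite of a row `Φ` with a 2-cell `ψ` is `vcomp Φ ψ`. The laws are equations of 2-cells whose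
frames agree only up to the laws of the category of tight-cells, whence heterogeneous equality. -/
class VirtualDoubleCategory (V : Type u) extends Category.{v} V where
  Loose : V → V → Type w
  Cell : ∀ ⦃A A' B B' : V⦄, (A ⟶ B) → LooseChain Loose A' A → (A' ⟶ B') → Loose B' B → Type z
  idCell : ∀ ⦃A B : V⦄ (p : Loose A B), Cell (𝟙 B) (.single p) (𝟙 A) p
  vcomp : ∀ ⦃A A' B B' D D' : V⦄ ⦃f : A ⟶ B⦄ ⦃ps : LooseChain Loose A' A⦄ ⦃g : A' ⟶ B'⦄
    ⦃qs : LooseChain Loose B' B⦄ ⦃f' : B ⟶ D⦄ ⦃g' : B' ⟶ D'⦄ ⦃s : Loose D' D⦄,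
    CellChain Cell f ps g qs → Cell f' qs g' s → Cell (f ≫ f') ps (g ≫ g') s
  vcomp_idCell : ∀ {A A' B B' : V} {f : A ⟶ B} {ps : LooseChain Loose A' A} {g : A' ⟶ B'}
    {q : Loose B' B} (φ : Cell f ps g q), HEq (vcomp (.single φ) (idCell q)) φ
  idCell_vcomp : ∀ {A A' B B' : V} {f : A ⟶ B} {ps : LooseChain Loose A' A} {g : A' ⟶ B'}
    {q : Loose B' B} (φ : Cell f ps g q), HEq (vcomp (.ids idCell ps) φ) φ
  vcomp_assoc : ∀ {A A' B B' D D' F F' : V} {f : A ⟶ B} {ps : LooseChain Loose A' A} {g : A' ⟶ B'}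
    {qs : LooseChain Loose B' B} {f' : B ⟶ D} {g' : B' ⟶ D'} {ss : LooseChain Loose D' D}
    {f'' : D ⟶ F} {g'' : D' ⟶ F'} {t : Loose F' F}
    {Θ : CellChain Cell f ps g qs} {Φ : CellChain Cell f' qs g' ss}
    {Ξ : CellChain Cell (f ≫ f') ps (g ≫ g') ss} (ψ : Cell f'' ss g'' t),
    CellChain.Paste vcomp Θ Φ Ξ → HEq (vcomp Ξ ψ) (vcomp Θ (vcomp Φ ψ))

open VirtualDoubleCategory (Loose Cell idCell vcomp)

section VirtualDoubleCategory

variable {V : Type u} [VirtualDoubleCategory.{u, v, w, z} V]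

/-- Weights `X ⇸ ⋯ ⇸ Y`. -/
abbrev Weight (X Y : V) := LooseChain (Loose (V := V)) X Y

/-- Globular 2-cells `p₁, …, pₘ ⇒ q`. -/
abbrev Glob {X Y : V} (ps : Weight X Y) (q : Loose X Y) := Cell (𝟙 Y) ps (𝟙 X) q

/-- Transport of a 2-cell along equalities of its sides. -/
def castCell {A A' B B' : V} {f k : A ⟶ B} {ps : Weight A' A} {g l : A' ⟶ B'} {q : Loose B' B}
    (hf : f = k) (hg : g = l) (φ : Cell f ps g q) : Cell k ps l q :=
  hf ▸ hg ▸ φ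

/-- The row of identity 2-cells on a chain. -/
def ids {X Y : V} (ps : Weight X Y) : CellChain Cell (𝟙 Y) ps (𝟙 X) ps :=
  CellChain.ids idCell ps

/-- Composite of a row of 2-cells with a globular 2-cell below it. -/
def compGlob {A A' B B' : V} {f : A ⟶ B} {ps : Weight A' A} {g : A' ⟶ B'} {qs : Weight B' B}
    {s : Loose B' B} (Φ : CellChain Cell f ps g qs) (ψ : Glob qs s) : Cell f ps g s :=
  castCell (Category.comp_id f) (Category.comp_id g) (vcomp Φ ψ)

/-- Composite of a row of 2-cells with outer sides identities, and a 2-cell below it. -/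
def globComp {A A' B B' : V} {ps qs : Weight A' A} {f : A ⟶ B} {g : A' ⟶ B'}
    {s : Loose B' B} (Φ : CellChain Cell (𝟙 A) ps (𝟙 A') qs) (ψ : Cell f qs g s) :
    Cell f ps g s :=
  castCell (Category.id_comp f) (Category.id_comp g) (vcomp Φ ψ)

/-- A globular 2-cell with unary domain is invertible. -/
def IsInvertible {X Y : V} {p q : Loose X Y} (α : Glob (.single p) q) : Prop :=
  ∃ β : Glob (.single q) p, compGlob (.single α) β = idCell p ∧ compGlob (.single β) α = idCell q

/-- `p ≅ q` for loose-cells. -/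
def LooseIso {X Y : V} (p q : Loose X Y) : Prop :=
  ∃ α : Glob (.single p) q, IsInvertible α

def IsCartesian {A A' B B' : V} {f : A ⟶ B} {p : Loose A' A} {g : A' ⟶ B'} {q : Loose B' B}
    (κ : Cell f (.single p) g q) : Prop :=
  ∀ {D D' : V} (f' : D ⟶ A) (rs : Weight D' D) (g' : D' ⟶ A') (φ : Cell (f' ≫ f) rs (g' ≫ g) q),
    ∃! ψ : Cell f' rs g' p, vcomp (.single ψ) κ = φ

def IsOpcartesian {X Y : V} {qs : Weight X Y} {q : Loose X Y} (κ : Glob qs q) : Prop :=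
  ∀ {A A' B B' : V} (ps : Weight Y A) (rs : Weight A' X) (f : A ⟶ B) (g : A' ⟶ B')
    (s : Loose B' B) (φ : Cell f (ps.append (qs.append rs)) g s),
    ∃! ψ : Cell f (ps.append (.cons q rs)) g s,
      globComp ((ids ps).append (.cons rfl κ (ids rs))) ψ = φ

/-- `(l, ϖ)` is the right lift of `q` through the weight `ps`. -/
def IsRightLift {X Y Z : V} (ps : Weight Y Z) (q : Loose X Z) (l : Loose X Y)
    (ϖ : Glob (ps.append (.single l)) q) : Prop :=
  ∀ (rs : Weight X Y) (φ : Glob (ps.append rs) q),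
    ∃! ψ : Glob rs l, globComp ((ids ps).append (.single ψ)) ϖ = φ

/-- A weight is lifting if all right lifts through it exist. -/
def IsLifting {Y Z : V} (ps : Weight Y Z) : Prop :=
  ∀ (X : V) (q : Loose X Z), ∃ (l : Loose X Y) (ϖ : Glob (ps.append (.single l)) q),
    IsRightLift ps q l ϖ

end VirtualDoubleCategory

/-- A virtual equipment: a virtual double category with all loose-identities and all restrictions,
a choice of which is part of the data. `looseId A` is `A(1, 1)`, and `restr q f g` is `q(f, g)`. -/
class VirtualEquipment (V : Type u) [VirtualDoubleCategory.{u, v, w, z} V] where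
  looseId : ∀ A : V, Loose A A
  unit : ∀ A : V, Glob .nil (looseId A)
  unit_opcartesian : ∀ A : V, IsOpcartesian (unit A)
  restr : ∀ {A A' B B' : V} (_ : Loose B' B) (_ : A ⟶ B) (_ : A' ⟶ B'), Loose A' A
  cart : ∀ {A A' B B' : V} (q : Loose B' B) (f : A ⟶ B) (g : A' ⟶ B'),
    Cell f (.single (restr q f g)) g q
  cart_cartesian : ∀ {A A' B B' : V} (q : Loose B' B) (f : A ⟶ B) (g : A' ⟶ B'),
    IsCartesian (cart q f g)

open VirtualEquipment (looseId unit unit_opcartesian restr cart cart_cartesian)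

section VirtualEquipment

variable {V : Type u} [VirtualDoubleCategory.{u, v, w, z} V] [VirtualEquipment V]

/-! Canonical 2-cells -/

/-- The unique factorisation of a 2-cell through the cartesian 2-cell of `q(f, g)`. -/
noncomputable def factor {A A' B B' D D' : V} (q : Loose B' B) (f : A ⟶ B) (g : A' ⟶ B')
    (f' : D ⟶ A) (g' : D' ⟶ A') {rs : Weight D' D} {k : D ⟶ B} {l : D' ⟶ B'}
    (hk : k = f' ≫ f) (hl : l = g' ≫ g) (φ : Cell k rs l q) : Cell f' rs g' (restr q f g) :=
  (cart_cartesian q f g f' rs g' (castCell hk hl φ)).choose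

/-- The special case of `factor` for a 2-cell whose sides are exactly `f` and `g`. -/
noncomputable def factorGlob {A A' B B' : V} (q : Loose B' B) (f : A ⟶ B) (g : A' ⟶ B')
    {rs : Weight A' A} (φ : Cell f rs g q) : Glob rs (restr q f g) :=
  factor q f g (𝟙 A) (𝟙 A') (Category.id_comp f).symm (Category.id_comp g).symm φ

/-- The canonical 2-cell `B(1, 1), p ⇒ p`. -/
noncomputable def leftUnitor {A B : V} (p : Loose A B) : Glob (.cons (looseId B) (.single p)) p :=
  (unit_opcartesian B .nil (.single p) (𝟙 B) (𝟙 A) p (idCell p)).choose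

/-- The canonical 2-cell `p, A(1, 1) ⇒ p`. -/
noncomputable def rightUnitor {A B : V} (p : Loose A B) : Glob (.cons p (.single (looseId A))) p :=
  (unit_opcartesian A (.single p) .nil (𝟙 B) (𝟙 A) p (idCell p)).choose

/-- The loose-cell `X(f, g)`. -/
abbrev hom {A B X : V} (f : A ⟶ X) (g : B ⟶ X) : Loose B A := restr (looseId X) f g

/-- The conjoint `B(f, 1)`. -/
abbrev conjoint {A B : V} (f : A ⟶ B) : Loose B A := hom f (𝟙 B)

/-- 2-cells `f ⇒ g` between tight-cells. -/
abbrev TightTwoCell {A B : V} (f g : A ⟶ B) := Cell f .nil g (looseId B)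

/-- The identity 2-cell on a tight-cell. -/
def tightOne {A B : V} (f : A ⟶ B) : TightTwoCell f f :=
  compGlob (.nil f) (unit B)

/-- The composite of `α : f ⇒ g` and `β : g ⇒ h`. -/
noncomputable def tightComp {A B : V} {f g h : A ⟶ B} (α : TightTwoCell f g)
    (β : TightTwoCell g h) : TightTwoCell f h :=
  compGlob (.pair α β) (leftUnitor (looseId B))

def IsTightInvertible {A B : V} {f g : A ⟶ B} (α : TightTwoCell f g) : Prop :=
  ∃ β : TightTwoCell g f, tightComp α β = tightOne f ∧ tightComp β α = tightOne g

/-- `f ≅ g` for tight-cells. -/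
def TightIso {A B : V} (f g : A ⟶ B) : Prop :=
  ∃ α : TightTwoCell f g, IsTightInvertible α

/-- The action of `f` on loose-identities: the unique 2-cell `A(1, 1) ⇒ B(1, 1)` with both sides
`f` that restricts along the unit of `A(1, 1)` to the identity 2-cell on `f`. -/
noncomputable def looseIdMap {A B : V} (f : A ⟶ B) :
    Cell f (.single (looseId A)) f (looseId B) :=
  (unit_opcartesian A .nil .nil f f (looseId B) (tightOne f)).choose

/-- The canonical 2-cell `A(1, 1) ⇒ B(f, f)`. -/
noncomputable def homMap {A B : V} (f : A ⟶ B) : Glob (.single (looseId A)) (hom f f) :=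
  factorGlob (looseId B) f f (looseIdMap f)

/-- The nullary 2-cell into `B(f, 1)` with left side `1` and right side `f`, corresponding to the
identity 2-cell on `f`. -/
noncomputable def conjointUnit {A B : V} (f : A ⟶ B) :
    Cell (𝟙 A) .nil f (conjoint f) :=
  factor (looseId B) f (𝟙 B) (𝟙 A) f (Category.id_comp f).symm (Category.comp_id f).symm
    (tightOne f)

/-- For `p : W ⇸ X`, the canonical 2-cell `X(g, c), p(c, 1) ⇒ p(g, 1)`. -/
noncomputable def action {W X Y Z : V} (p : Loose W X) (g : Z ⟶ X) (c : Y ⟶ X) :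
    Glob (.cons (hom g c) (.single (restr p c (𝟙 W)))) (restr p g (𝟙 W)) :=
  factorGlob p g (𝟙 W)
    (compGlob (.pair (cart (looseId X) g c) (cart p c (𝟙 W))) (leftUnitor p))

/-! Weighted colimits. A `ps`-cocone for `f : Z ⟶ X` is a pair of a tight-cell `c : Y ⟶ X` and a
2-cell `γ : Glob ps (hom f c)`. -/

/-- For `p : W ⇸ X` and a `ps`-cocone `(c, γ)` for `f`, the canonical 2-cell
`ps, p(c, 1) ⇒ p(f, 1)`. -/
noncomputable def coconeAction {W X Y Z : V} {ps : Weight Y Z} {f : Z ⟶ X} {c : Y ⟶ X}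
    (γ : Glob ps (hom f c)) (p : Loose W X) :
    Glob (ps.append (.single (restr p c (𝟙 W)))) (restr p f (𝟙 W)) :=
  globComp (.pair γ (idCell _)) (action p f c)

/-- The cocone `(c, γ)` for `f` is colimiting: `X(c, 1)` is the right lift of `X(f, 1)` through
`ps`. -/
def IsColimit {X Y Z : V} {ps : Weight Y Z} (f : Z ⟶ X) (c : Y ⟶ X) (γ : Glob ps (hom f c)) :
    Prop :=
  IsRightLift ps (conjoint f) (conjoint c) (coconeAction γ (looseId X))

/-- The cocone `γ ≫ g`, consisting of `c ≫ g` and `ps ⇒ X(f, c) ⇒ X'(f ≫ g, c ≫ g)`. -/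
noncomputable def coconeMap {X X' Y Z : V} {ps : Weight Y Z} {f : Z ⟶ X} {c : Y ⟶ X}
    (γ : Glob ps (hom f c)) (g : X ⟶ X') : Glob ps (hom (f ≫ g) (c ≫ g)) :=
  factorGlob (looseId X') (f ≫ g) (c ≫ g)
    (vcomp (.single (globComp (.single γ) (cart (looseId X) f c))) (looseIdMap g))

/-- `g` preserves the colimit `(c, γ)` of `f`. -/
def Preserves {X X' Y Z : V} (g : X ⟶ X') {ps : Weight Y Z} (f : Z ⟶ X) (c : Y ⟶ X)
    (γ : Glob ps (hom f c)) : Prop :=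
  IsColimit (f ≫ g) (c ≫ g) (coconeMap γ g)

/-- The loose-cell `p` respects the colimit `(c, γ)` of `f`. -/
def Respects {W X Y Z : V} (p : Loose W X) {ps : Weight Y Z} (f : Z ⟶ X) (c : Y ⟶ X)
    (γ : Glob ps (hom f c)) : Prop :=
  IsRightLift ps (restr p f (𝟙 W)) (restr p c (𝟙 W)) (coconeAction γ p)

/-- `(c, γ)` is the pointwise left extension of `f` along `j`. -/
def IsLeftExtension {X Y Z : V} (j : Z ⟶ Y) (f : Z ⟶ X) (c : Y ⟶ X)
    (γ : Glob (.single (conjoint j)) (hom f c)) : Prop :=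
  IsColimit f c γ

/-- The unit `f ⇒ j ≫ c` of a left extension `(c, γ)` of `f` along `j`. -/
noncomputable def leftExtensionUnit {X Y Z : V} (j : Z ⟶ Y) (f : Z ⟶ X) (c : Y ⟶ X)
    (γ : Glob (.single (conjoint j)) (hom f c)) : TightTwoCell f (j ≫ c) :=
  castCell (Category.id_comp f) rfl
    (vcomp (.single (compGlob (.single (conjointUnit j)) γ)) (cart (looseId X) f c))

/-- For `ϖ : E(j, 1), l ⇒ p`, the corresponding 2-cell `l(j, 1) ⇒ p`. -/
noncomputable def counitRestr {A E X : V} (j : A ⟶ E) (p : Loose X A) (l : Loose X E)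
    (ϖ : Glob (.cons (conjoint j) (.single l)) p) : Glob (.single (restr l j (𝟙 X))) p :=
  compGlob (.pair (conjointUnit j) (cart l j (𝟙 X))) ϖ

/-- `j` is dense: its conjoint `p` is a dense loose-cell, that is, the 2-cell `p, E(1, 1) ⇒ p`
corresponding to the identity of `p` exhibits `E(1, 1)` as the right lift of `p` through `p`. -/
def IsDense {A E : V} (j : A ⟶ E) : Prop :=
  IsRightLift (.single (conjoint j)) (conjoint j) (looseId E) (rightUnitor (conjoint j))

/-- `j` is fully faithful: `A(1, 1) ≅ E(j, j)` canonically. -/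
def IsFullyFaithful {A E : V} (j : A ⟶ E) : Prop :=
  IsInvertible (homMap j)

/-! Classes of weights -/

variable (V) in
/-- Classes of weights, ordered by inclusion. -/
abbrev WeightClass := ∀ X Y : V, Set (Weight X Y)

def IsCocomplete (Φ : WeightClass V) (A : V) : Prop :=
  ∀ {W D : V} (ps : Weight W D), ps ∈ Φ W D → ∀ f : D ⟶ A,
    ∃ (c : W ⟶ A) (γ : Glob ps (hom f c)), IsColimit f c γ

/-- The domain of `g` is cocomplete and `g` preserves every `Φ`-colimit. -/
def IsCocontinuous (Φ : WeightClass V) {A B : V} (g : A ⟶ B) : Prop :=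
  IsCocomplete Φ A ∧ ∀ {W D : V} (ps : Weight W D), ps ∈ Φ W D →
    ∀ (f : D ⟶ A) (c : W ⟶ A) (γ : Glob ps (hom f c)), IsColimit f c γ → Preserves g f c γ

/-- The codomain of `p` is cocomplete and `p` respects every `Φ`-colimit. -/
def IsExact (Φ : WeightClass V) {X A : V} (p : Loose X A) : Prop :=
  IsCocomplete Φ A ∧ ∀ {W D : V} (ps : Weight W D), ps ∈ Φ W D →
    ∀ (f : D ⟶ A) (c : W ⟶ A) (γ : Glob ps (hom f c)), IsColimit f c γ → Respects p f c γ

/-- The preorder whose associated equivalence relation is colimit equivalence. -/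
def ColimitLE (Φ Φ' : WeightClass V) : Prop :=
  (∀ A : V, IsCocomplete Φ' A → IsCocomplete Φ A) ∧
  (∀ {A B : V} (g : A ⟶ B), IsCocontinuous Φ' g → IsCocontinuous Φ g) ∧
  (∀ {X A : V} (p : Loose X A), IsExact Φ' p → IsExact Φ p)

def ColimitEquiv (Φ Φ' : WeightClass V) : Prop := ColimitLE Φ Φ' ∧ ColimitLE Φ' Φ

/-- The colimit saturation of `Φ`: the union of all classes of weights that are colimit equivalent
to `Φ`. By `saturation_isGreatest` it is the largest such class. -/
def saturation (Φ : WeightClass V) : WeightClass V :=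
  fun X Y => {ps | ∃ Φ' : WeightClass V, ColimitEquiv Φ' Φ ∧ ps ∈ Φ' X Y}

theorem saturation_isGreatest (Φ : WeightClass V) :
    IsGreatest {Φ' : WeightClass V | ColimitEquiv Φ' Φ} (saturation Φ) := by
  have hle : Φ ≤ saturation Φ := fun X Y ps h =>
    ⟨Φ, ⟨⟨fun _ h => h, fun _ h => h, fun _ h => h⟩, fun _ h => h, fun _ h => h, fun _ h => h⟩, h⟩
  have hc : ∀ A : V, IsCocomplete Φ A → IsCocomplete (saturation Φ) A := by
    rintro A hA W D ps ⟨Φ', h, hps⟩ f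
    exact h.1.1 A hA ps hps f
  refine ⟨⟨⟨hc, ?_, ?_⟩, ?_, ?_, ?_⟩, fun Φ' h X Y ps hps => ⟨Φ', h, hps⟩⟩
  · refine fun g hg => ⟨hc _ hg.1, ?_⟩
    rintro W D ps ⟨Φ', h, hps⟩ f c γ hγ
    exact (h.1.2.1 g hg).2 ps hps f c γ hγ
  · refine fun p hp => ⟨hc _ hp.1, ?_⟩
    rintro W D ps ⟨Φ', h, hps⟩ f c γ hγ
    exact (h.1.2.2 p hp).2 ps hps f c γ hγ
  · exact fun A hA W D ps hps f => hA ps (hle _ _ hps) f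
  · exact fun g hg => ⟨fun ps hps f => hg.1 ps (hle _ _ hps) f,
      fun ps hps f c γ hγ => hg.2 ps (hle _ _ hps) f c γ hγ⟩
  · exact fun p hp => ⟨fun ps hps f => hp.1 ps (hle _ _ hps) f,
      fun ps hps f c γ hγ => hp.2 ps (hle _ _ hps) f c γ hγ⟩

/-- `j : A ⟶ E` exhibits `E` as the `Φ`-cocompletion of `A`. -/
structure IsCocompletion (Φ : WeightClass V) {A E : V} (j : A ⟶ E) : Prop where
  cocomplete : IsCocomplete Φ E
  tight : ∀ {X : V} (f : A ⟶ X), IsCocomplete Φ X →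
    ∃ (c : E ⟶ X) (γ : Glob (.single (conjoint j)) (hom f c)),
      IsLeftExtension j f c γ ∧ IsTightInvertible (leftExtensionUnit j f c γ) ∧
      IsCocontinuous Φ c ∧
      ∀ f' : E ⟶ X, IsCocontinuous Φ f' → TightIso f (j ≫ f') → TightIso f' c
  loose : ∀ {X : V} (p : Loose X A),
    ∃ (l : Loose X E) (ϖ : Glob (.cons (conjoint j) (.single l)) p),
      IsRightLift (.single (conjoint j)) p l ϖ ∧ IsInvertible (counitRestr j p l ϖ) ∧
      IsExact Φ l ∧
      ∀ p' : Loose X E, IsExact Φ p' → LooseIso p (restr p' j (𝟙 X)) → LooseIso p' l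

end VirtualEquipment

end VDC

/-! Everything rests on one notion. A cocone `γ : ps ⇒ X(f, c)` is the same as a 2-cell `u` into
`X(1, 1)` with top `ps` and sides `f`, `c`, and `Exhibits p u` says that acting with `u` gives
bijections from 2-cells into `p` with left side `c` to 2-cells into `p` with left side `f`. By
cartesianness this means that `p` respects the cocone (`respects_iff`); colimits are the case `p =
X(1, 1)`. Restricting `p` along `g` amounts to mapping `u` along `g` (`exhibits_restr_iff`). Hence a
tight-cell is cocontinuous exactly when its conjoint is exact, and exact loose-cells restrict along
cocontinuous tight-cells to exact ones. Take now the cocone on `j` with apex `1` and the identity of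
`E(j, 1)`. It is a colimit iff `j` is dense (`isDense_iff`), and `m` respects it iff `m` is the
right lift of `m(j, 1)` through `E(j, 1)` (`exhibits_conjoint_iff`).

Assume the four conditions. Saturation supplies left extensions `c` along `j`; as `X(c, 1)` is a
right lift through `E(j, 1)`, it is exact, so `c` is cocontinuous. Full faithfulness makes the units
and counits invertible, because lifting through `E(j, 1)` and restricting along `j` is lifting
through `E(j, j) ≅ A(1, 1)` (`IsFullyFaithful.lift_bijective`). Uniqueness comes from density:
cocontinuous tight-cells and exact loose-cells respect the colimit of `j`, so they are determined by
their restrictions along `j`.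

Conversely, let `j` exhibit the cocompletion. By uniqueness every exact `m` is the lift of `m(j, 1)`
(`IsCocompletion.exhibits`); `m = E(1, 1)` gives density. Restricting an exact `p` along a left
extension shows that `p` respects it, so `E(j, 1)` can be added to `Φ` without changing the notions
that `Φ` defines (`IsCocompletion.mem_saturation`). Full faithfulness follows from invertibility of
the counits (`isFullyFaithful_of_lifts`). -/

namespace VDC

/-! ### Rows of 2-cells with concatenations up to equality -/

namespace CellChain

variable {V : Type u} [Category.{v} V] {L : V → V → Type w}
  {C : ∀ ⦃A A' B B' : V⦄, (A ⟶ B) → LooseChain L A' A → (A' ⟶ B') → L B' B → Type z}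

/-- Juxtaposition of two rows, with the concatenations given up to equality. -/
def appendOf {A A' A'' B B' B'' : V} {f : A ⟶ B} {g : A' ⟶ B'} {h : A'' ⟶ B''}
    {ps : LooseChain L A' A} {qs : LooseChain L B' B}
    {ps' : LooseChain L A'' A'} {qs' : LooseChain L B'' B'}
    {ts : LooseChain L A'' A} {us : LooseChain L B'' B}
    (Θ : CellChain C f ps g qs) (Θ' : CellChain C g ps' h qs')
    (hts : ts = ps.append ps') (hus : us = qs.append qs') : CellChain C f ts h us :=
  hts ▸ hus ▸ Θ.append Θ'

/-- Since `ps.append .nil = ps` is not definitional, the unit law carries a transport; it is proved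
heterogeneously by induction on the row. -/
theorem appendOf_nil {A A' B B' : V} {f : A ⟶ B} {g : A' ⟶ B'}
    {ps : LooseChain L A' A} {qs : LooseChain L B' B} (Θ : CellChain C f ps g qs) :
    Θ.appendOf (.nil g) (LooseChain.append_nil ps).symm (LooseChain.append_nil qs).symm = Θ := by
  suffices h : ∀ {ts us} (hts : ts = ps.append .nil) (hus : us = qs.append .nil),
      HEq (Θ.appendOf (.nil g) hts hus) Θ from eq_of_heq (h _ _)
  rintro _ _ rfl rfl
  change HEq (Θ.append (.nil g)) Θ
  induction Θ with
  | nil f => rfl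
  | @cons A A' A'' B B' B'' f g h ps ps' ts q qs e φ φs ih =>
    subst e
    have key : ∀ {a : LooseChain L A'' A'} {b : LooseChain L B'' B'} (ha : a = ps') (hb : b = qs)
        (X : CellChain C g a h b) (_ : HEq X φs) {t : LooseChain L A'' A} (ht : t = ps.append a),
        HEq (CellChain.cons ht φ X) (CellChain.cons (rfl : ps.append ps' = _) φ φs) := by
      rintro _ _ rfl rfl X hX _ rfl
      cases hX
      rfl
    exact key (LooseChain.append_nil _) (LooseChain.append_nil _) _ ih _

end CellChain

open VirtualDoubleCategory (Loose Cell idCell vcomp)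
open VirtualEquipment (looseId unit unit_opcartesian restr cart cart_cartesian)

/-! ### Stacking of rows and associativity of composition -/

section Rows

variable {V : Type u} [VirtualDoubleCategory.{u, v, w, z} V]

/-- Composite of a row of 2-cells with a 2-cell below it, with the sides given up to equality. -/
def compRow {A A' B B' D D' : V} {f : A ⟶ B} {ps : Weight A' A} {g : A' ⟶ B'} {qs : Weight B' B}
    {f' : B ⟶ D} {g' : B' ⟶ D'} {s : Loose D' D} {k : A ⟶ D} {l : A' ⟶ D'}
    (Θ : CellChain Cell f ps g qs) (ψ : Cell f' qs g' s) (hk : f ≫ f' = k) (hl : g ≫ g' = l) :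
    Cell k ps l s :=
  castCell hk hl (vcomp Θ ψ)

/-- Stacking of rows, with all sides and concatenations given up to equality. -/
inductive Stack : ∀ {A A' B B' D D' : V} {f : A ⟶ B} {ps : Weight A' A} {g : A' ⟶ B'}
    {qs : Weight B' B} {f' : B ⟶ D} {g' : B' ⟶ D'} {ss : Weight D' D} {k : A ⟶ D} {l : A' ⟶ D'},
    CellChain Cell f ps g qs → CellChain Cell f' qs g' ss → CellChain Cell k ps l ss → Prop
  | nil {A B D : V} (f : A ⟶ B) (f' : B ⟶ D) {k : A ⟶ D} (hk : f ≫ f' = k) :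
      Stack (.nil f) (.nil f') (.nil k)
  | cons {A A' A'' B B' B'' D D' D'' : V} {f : A ⟶ B} {g : A' ⟶ B'} {h : A'' ⟶ B''}
      {f' : B ⟶ D} {g' : B' ⟶ D'} {h' : B'' ⟶ D''} {k : A ⟶ D} {m : A' ⟶ D'} {l : A'' ⟶ D''}
      {ps : Weight A' A} {qs : Weight B' B} {s : Loose D' D}
      {ps' : Weight A'' A'} {qs' : Weight B'' B'} {ss : Weight D'' D'}
      {ts : Weight A'' A} {us : Weight B'' B} (hts : ts = ps.append ps') (hus : us = qs.append qs')
      (hk : f ≫ f' = k) (hm : g ≫ g' = m)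
      (θ : CellChain Cell f ps g qs) (φ : Cell f' qs g' s)
      {Θ : CellChain Cell g ps' h qs'} {Φ : CellChain Cell g' qs' h' ss}
      {Ξ : CellChain Cell m ps' l ss} (H : Stack Θ Φ Ξ) :
      Stack (θ.appendOf Θ hts hus) (.cons hus φ Φ) (.cons hts (compRow θ φ hk hm) Ξ)

/-- `Paste` forces the sides to be literal composites, whereas `Stack` leaves them free; the
equations stored in a stack suffice to return to `Paste`, where the associativity axiom applies. -/
theorem Stack.paste {A A' B B' D D' : V} {f : A ⟶ B} {ps : Weight A' A} {g : A' ⟶ B'}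
    {qs : Weight B' B} {f' : B ⟶ D} {g' : B' ⟶ D'} {ss : Weight D' D} {k : A ⟶ D} {l : A' ⟶ D'}
    {Θ : CellChain Cell f ps g qs} {Φ : CellChain Cell f' qs g' ss} {Ξ : CellChain Cell k ps l ss}
    (H : Stack Θ Φ Ξ) : f ≫ f' = k ∧ g ≫ g' = l ∧
      ∃ Ξ' : CellChain Cell (f ≫ f') ps (g ≫ g') ss, HEq Ξ' Ξ ∧ CellChain.Paste vcomp Θ Φ Ξ' := by
  induction H with
  | nil f f' hk => subst hk; exact ⟨rfl, rfl, _, HEq.rfl, .nil f f'⟩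
  | cons hts hus hk hm θ φ H ih =>
    obtain ⟨h1, h2, Ξ', h3, h4⟩ := ih
    subst hts hus hk hm h2
    cases h3
    exact ⟨rfl, rfl, _, HEq.rfl, .cons θ φ h4⟩

/-- Associativity in the form used from here on: the side equations are arguments, so the casts stay
inside `compRow` and never enter a calculation. -/
theorem Stack.compRow {A A' B B' D D' F F' : V} {f : A ⟶ B} {ps : Weight A' A} {g : A' ⟶ B'}
    {qs : Weight B' B} {f' : B ⟶ D} {g' : B' ⟶ D'} {ss : Weight D' D} {k : A ⟶ D} {l : A' ⟶ D'}
    {Θ : CellChain Cell f ps g qs} {Φ : CellChain Cell f' qs g' ss} {Ξ : CellChain Cell k ps l ss}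
    (H : Stack Θ Φ Ξ) {f'' : D ⟶ F} {g'' : D' ⟶ F'} {t : Loose F' F} (ψ : Cell f'' ss g'' t)
    {a : B ⟶ F} {b : B' ⟶ F'} {c : A ⟶ F} {d : A' ⟶ F'}
    (ha : f' ≫ f'' = a) (hb : g' ≫ g'' = b) (hc : k ≫ f'' = c) (hd : l ≫ g'' = d)
    (hc' : f ≫ a = c) (hd' : g ≫ b = d) :
    compRow Θ (compRow Φ ψ ha hb) hc' hd' = compRow Ξ ψ hc hd := by
  obtain ⟨h1, h2, Ξ', h3, h4⟩ := H.paste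
  subst h1 h2
  cases h3
  subst ha hb hc hd
  have := VirtualDoubleCategory.vcomp_assoc ψ h4
  apply eq_of_heq
  refine HEq.trans ?_ this.symm
  have key : ∀ {k l} (hk : f ≫ f' ≫ f'' = k) (hl : g ≫ g' ≫ g'' = l),
      HEq (castCell hk hl (vcomp Θ (vcomp Φ ψ))) (vcomp Θ (vcomp Φ ψ)) := by
    rintro _ _ rfl rfl; rfl
  exact key hc' hd'

/-- Composite of two 2-cells. -/
def comp1 {A A' B B' D D' : V} {f : A ⟶ B} {ps : Weight A' A} {g : A' ⟶ B'} {q : Loose B' B}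
    {f' : B ⟶ D} {g' : B' ⟶ D'} {s : Loose D' D} {k : A ⟶ D} {l : A' ⟶ D'}
    (x : Cell f ps g q) (ψ : Cell f' (.single q) g' s) (hk : f ≫ f' = k) (hl : g ≫ g' = l) :
    Cell k ps l s :=
  compRow (.single x) ψ hk hl

/-- Composite of a row of two 2-cells with a 2-cell below it. -/
def comp2 {A A' A'' B B' B'' D D'' : V} {f : A ⟶ B} {ps : Weight A' A} {g : A' ⟶ B'}
    {q : Loose B' B} {ps' : Weight A'' A'} {h : A'' ⟶ B''} {q' : Loose B'' B'}
    {f' : B ⟶ D} {h' : B'' ⟶ D''} {s : Loose D'' D} {k : A ⟶ D} {l : A'' ⟶ D''}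
    (x : Cell f ps g q) (y : Cell g ps' h q') (ψ : Cell f' (.cons q (.single q')) h' s)
    (hk : f ≫ f' = k) (hl : h ≫ h' = l) : Cell k (ps.append ps') l s :=
  compRow (.pair x y) ψ hk hl

theorem compRow_comp1 {A A' B B' D D' F F' : V} {f : A ⟶ B} {ps : Weight A' A} {g : A' ⟶ B'}
    {qs : Weight B' B} {f' : B ⟶ D} {g' : B' ⟶ D'} {s : Loose D' D} {k : A ⟶ D} {l : A' ⟶ D'}
    {f'' : D ⟶ F} {g'' : D' ⟶ F'} {t : Loose F' F}
    {a : B ⟶ F} {b : B' ⟶ F'} {c : A ⟶ F} {d : A' ⟶ F'}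
    (Θ : CellChain Cell f ps g qs) (x : Cell f' qs g' s) (ψ : Cell f'' (.single s) g'' t)
    (ha : f' ≫ f'' = a) (hb : g' ≫ g'' = b) (hc' : f ≫ a = c) (hd' : g ≫ b = d)
    (hk : f ≫ f' = k) (hl : g ≫ g' = l) (hc : k ≫ f'' = c) (hd : l ≫ g'' = d) :
    compRow Θ (comp1 x ψ ha hb) hc' hd' = comp1 (compRow Θ x hk hl) ψ hc hd := by
  have H := Stack.cons (LooseChain.append_nil ps).symm (LooseChain.append_nil qs).symm hk hl Θ x
    (Stack.nil g g' hl)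
  rw [CellChain.appendOf_nil] at H
  exact H.compRow ψ ha hb hc hd hc' hd'

theorem compRow_comp2 {A A' A'' B B' B'' D D' D'' F F'' : V}
    {f : A ⟶ B} {ps : Weight A' A} {g : A' ⟶ B'} {qs : Weight B' B}
    {ps' : Weight A'' A'} {h : A'' ⟶ B''} {qs' : Weight B'' B'}
    {f' : B ⟶ D} {g' : B' ⟶ D'} {h' : B'' ⟶ D''} {s : Loose D' D} {s' : Loose D'' D'}
    {k : A ⟶ D} {m : A' ⟶ D'} {l : A'' ⟶ D''}
    {f'' : D ⟶ F} {h'' : D'' ⟶ F''} {t : Loose F'' F}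
    {a : B ⟶ F} {b : B'' ⟶ F''} {c : A ⟶ F} {d : A'' ⟶ F''}
    (Θ : CellChain Cell f ps g qs) (Θ' : CellChain Cell g ps' h qs')
    (x : Cell f' qs g' s) (y : Cell g' qs' h' s') (ψ : Cell f'' (.cons s (.single s')) h'' t)
    (ha : f' ≫ f'' = a) (hb : h' ≫ h'' = b) (hc' : f ≫ a = c) (hd' : h ≫ b = d)
    (hk : f ≫ f' = k) (hm : g ≫ g' = m) (hl : h ≫ h' = l) (hc : k ≫ f'' = c) (hd : l ≫ h'' = d) :
    compRow (Θ.append Θ') (comp2 x y ψ ha hb) hc' hd' =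
      comp2 (compRow Θ x hk hm) (compRow Θ' y hm hl) ψ hc hd := by
  have H := Stack.cons (LooseChain.append_nil ps').symm (LooseChain.append_nil qs').symm hm hl Θ' y
    (Stack.nil h h' hl)
  rw [CellChain.appendOf_nil] at H
  exact (Stack.cons rfl rfl hk hm Θ x H).compRow ψ ha hb hc hd hc' hd'

theorem compRow_ids {A A' B B' : V} {f : A ⟶ B} {ps : Weight A' A} {g : A' ⟶ B'}
    {q : Loose B' B} (x : Cell f ps g q) (hk : 𝟙 A ≫ f = f) (hl : 𝟙 A' ≫ g = g) :
    compRow (ids ps) x hk hl = x := by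
  apply eq_of_heq
  refine HEq.trans ?_ (VirtualDoubleCategory.idCell_vcomp x)
  have key : ∀ {k l} (hk : 𝟙 A ≫ f = k) (hl : 𝟙 A' ≫ g = l),
      HEq (castCell hk hl (vcomp (ids ps) x)) (vcomp (ids ps) x) := by
    rintro _ _ rfl rfl; rfl
  exact key hk hl

theorem comp1_id {A A' B B' : V} {f : A ⟶ B} {ps : Weight A' A} {g : A' ⟶ B'}
    {q : Loose B' B} (x : Cell f ps g q) (hk : f ≫ 𝟙 B = f) (hl : g ≫ 𝟙 B' = g) :
    comp1 x (idCell q) hk hl = x := by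
  apply eq_of_heq
  refine HEq.trans ?_ (VirtualDoubleCategory.vcomp_idCell x)
  have key : ∀ {k l} (hk : f ≫ 𝟙 B = k) (hl : g ≫ 𝟙 B' = l),
      HEq (castCell hk hl (vcomp (.single x) (idCell q))) (vcomp (.single x) (idCell q)) := by
    rintro _ _ rfl rfl; rfl
  exact key hk hl

theorem id_comp1 {A A' B B' : V} {f : A ⟶ B} {p : Loose A' A} {g : A' ⟶ B'}
    {q : Loose B' B} (x : Cell f (.single p) g q) (hk : 𝟙 A ≫ f = f) (hl : 𝟙 A' ≫ g = g) :
    comp1 (idCell p) x hk hl = x :=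
  compRow_ids x hk hl

theorem id_comp2 {A A' A'' B B'' : V} {f : A ⟶ B} {p : Loose A' A} {p' : Loose A'' A'}
    {g : A'' ⟶ B''} {q : Loose B'' B} (x : Cell f (.cons p (.single p')) g q)
    (hk : 𝟙 A ≫ f = f) (hl : 𝟙 A'' ≫ g = g) :
    comp2 (idCell p) (idCell p') x hk hl = x :=
  compRow_ids x hk hl

end Rows

/-! ### Associativity for unary and binary composites -/

section Composites

variable {V : Type u} [VirtualDoubleCategory.{u, v, w, z} V]

theorem comp1_assoc {A A' B B' D D' F F' : V} {f : A ⟶ B} {ps : Weight A' A} {g : A' ⟶ B'}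
    {q : Loose B' B} {f' : B ⟶ D} {g' : B' ⟶ D'} {s : Loose D' D} {k : A ⟶ D} {l : A' ⟶ D'}
    {f'' : D ⟶ F} {g'' : D' ⟶ F'} {t : Loose F' F}
    {a : B ⟶ F} {b : B' ⟶ F'} {c : A ⟶ F} {d : A' ⟶ F'}
    (y : Cell f ps g q) (x : Cell f' (.single q) g' s) (ψ : Cell f'' (.single s) g'' t)
    (ha : f' ≫ f'' = a) (hb : g' ≫ g'' = b) (hc' : f ≫ a = c) (hd' : g ≫ b = d)
    (hk : f ≫ f' = k) (hl : g ≫ g' = l) (hc : k ≫ f'' = c) (hd : l ≫ g'' = d) :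
    comp1 y (comp1 x ψ ha hb) hc' hd' = comp1 (comp1 y x hk hl) ψ hc hd :=
  compRow_comp1 _ _ _ _ _ _ _ _ _ _ _

theorem comp2_comp1 {A A' A'' B B' B'' D D'' F F'' : V} {f : A ⟶ B} {ps : Weight A' A}
    {g : A' ⟶ B'} {q : Loose B' B} {ps' : Weight A'' A'} {h : A'' ⟶ B''} {q' : Loose B'' B'}
    {f' : B ⟶ D} {h' : B'' ⟶ D''} {s : Loose D'' D} {k : A ⟶ D} {l : A'' ⟶ D''}
    {f'' : D ⟶ F} {h'' : D'' ⟶ F''} {t : Loose F'' F}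
    {a : B ⟶ F} {b : B'' ⟶ F''} {c : A ⟶ F} {d : A'' ⟶ F''}
    (y : Cell f ps g q) (y' : Cell g ps' h q') (x : Cell f' (.cons q (.single q')) h' s)
    (ψ : Cell f'' (.single s) h'' t)
    (ha : f' ≫ f'' = a) (hb : h' ≫ h'' = b) (hc' : f ≫ a = c) (hd' : h ≫ b = d)
    (hk : f ≫ f' = k) (hl : h ≫ h' = l) (hc : k ≫ f'' = c) (hd : l ≫ h'' = d) :
    comp2 y y' (comp1 x ψ ha hb) hc' hd' = comp1 (comp2 y y' x hk hl) ψ hc hd :=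
  compRow_comp1 _ _ _ _ _ _ _ _ _ _ _

theorem comp2_comp2 {A A' A'' B B' B'' D D' D'' F F'' : V}
    {f : A ⟶ B} {ps : Weight A' A} {g : A' ⟶ B'} {q : Loose B' B}
    {ps' : Weight A'' A'} {h : A'' ⟶ B''} {q' : Loose B'' B'}
    {f' : B ⟶ D} {g' : B' ⟶ D'} {h' : B'' ⟶ D''} {s : Loose D' D} {s' : Loose D'' D'}
    {k : A ⟶ D} {m : A' ⟶ D'} {l : A'' ⟶ D''}
    {f'' : D ⟶ F} {h'' : D'' ⟶ F''} {t : Loose F'' F}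
    {a : B ⟶ F} {b : B'' ⟶ F''} {c : A ⟶ F} {d : A'' ⟶ F''}
    (y : Cell f ps g q) (y' : Cell g ps' h q')
    (x : Cell f' (.single q) g' s) (x' : Cell g' (.single q') h' s')
    (ψ : Cell f'' (.cons s (.single s')) h'' t)
    (ha : f' ≫ f'' = a) (hb : h' ≫ h'' = b) (hc' : f ≫ a = c) (hd' : h ≫ b = d)
    (hk : f ≫ f' = k) (hm : g ≫ g' = m) (hl : h ≫ h' = l) (hc : k ≫ f'' = c) (hd : l ≫ h'' = d) :
    comp2 y y' (comp2 x x' ψ ha hb) hc' hd' =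
      comp2 (comp1 y x hk hm) (comp1 y' x' hm hl) ψ hc hd :=
  compRow_comp2 (.single y) (.single y') _ _ _ _ _ _ _ _ _ _ _ _

/-- A triple row composed with a binary composite that has its inner binary part on the right or on
the left. -/
theorem comp2_right_eq_left {A₀ A₁ A₂ A₃ B₀ B₁ B₂ B₃ D D' E F G G' : V}
    {f₀ : A₀ ⟶ B₀} {f₁ : A₁ ⟶ B₁} {f₂ : A₂ ⟶ B₂} {f₃ : A₃ ⟶ B₃}
    {ps : Weight A₁ A₀} {qs : Weight A₂ A₁} {rs : Weight A₃ A₂}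
    {p : Loose B₁ B₀} {q : Loose B₂ B₁} {r : Loose B₃ B₂}
    (x : Cell f₀ ps f₁ p) (y : Cell f₁ qs f₂ q) (t : Cell f₂ rs f₃ r)
    {k₀ : B₀ ⟶ D} {k₀' : B₀ ⟶ D'} {k₁ : B₁ ⟶ E} {k₂ : B₂ ⟶ F} {k₃ : B₃ ⟶ G} {k₃' : B₃ ⟶ G'}
    {a : Loose E D} {b : Loose G E} {c : Loose F D'} {d : Loose G' F} {H H' : V}
    {s : Loose H' H}
    {x' : Cell k₀ (.single p) k₁ a} {y' : Cell k₁ (.cons q (.single r)) k₃ b}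
    {x'' : Cell k₀' (.cons p (.single q)) k₂ c} {y'' : Cell k₂ (.single r) k₃' d}
    {m : D ⟶ H} {m' : D' ⟶ H} {n : G ⟶ H'} {n' : G' ⟶ H'} {ψ : Cell m (.cons a (.single b)) n s}
    {ψ' : Cell m' (.cons c (.single d)) n' s} {i : B₀ ⟶ H} {j : B₃ ⟶ H'}
    {hi : k₀ ≫ m = i} {hj : k₃ ≫ n = j} {hi' : k₀' ≫ m' = i} {hj' : k₃' ≫ n' = j}
    (h : comp2 x' y' ψ hi hj = comp2 x'' y'' ψ' hi' hj')
    {l₀ : A₀ ⟶ D} {l₀' : A₀ ⟶ D'} {l₁ : A₁ ⟶ E} {l₂ : A₂ ⟶ F} {l₃ : A₃ ⟶ G} {l₃' : A₃ ⟶ G'}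
    {e : A₀ ⟶ H} {e' : A₃ ⟶ H'}
    (h₀ : f₀ ≫ k₀ = l₀) (h₁ : f₁ ≫ k₁ = l₁) (h₂ : f₂ ≫ k₂ = l₂) (h₃ : f₃ ≫ k₃ = l₃)
    (h₀' : f₀ ≫ k₀' = l₀') (h₃' : f₃ ≫ k₃' = l₃')
    (he : l₀ ≫ m = e) (he' : l₃ ≫ n = e') (he₁ : l₀' ≫ m' = e) (he₁' : l₃' ≫ n' = e') :
    HEq (comp2 (comp1 x x' h₀ h₁) (comp2 y t y' h₁ h₃) ψ he he')
      (comp2 (comp2 x y x'' h₀' h₂) (comp1 t y'' h₂ h₃') ψ' he₁ he₁') := by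
  have hi₁ : f₀ ≫ i = e := by rw [← hi, ← Category.assoc, h₀, he]
  have hj₁ : f₃ ≫ j = e' := by rw [← hj, ← Category.assoc, h₃, he']
  have e₁ := compRow_comp2 (.single x) (.pair y t) x' y' ψ hi hj hi₁ hj₁ h₀ h₁ h₃ he he'
  have e₂ := compRow_comp2 (.pair x y) (.single t) x'' y'' ψ' hi' hj' hi₁ hj₁ h₀' h₂ h₃' he₁ he₁'
  refine (heq_of_eq e₁.symm).trans (HEq.trans ?_ (heq_of_eq e₂))
  rw [h]
  -- Both sides compose the same triple row; only the bracketing of its top differs, and that is not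
  -- definitional.
  have key : ∀ {ts ts'} (_ : ts = ts') (Θ : CellChain Cell f₀ ts f₃ (.cons p (.cons q (.single r))))
      (Θ' : CellChain Cell f₀ ts' f₃ (.cons p (.cons q (.single r)))) (_ : HEq Θ Θ')
      (ω : Cell i (.cons p (.cons q (.single r))) j s),
      HEq (compRow Θ ω hi₁ hj₁) (compRow Θ' ω hi₁ hj₁) := by
    rintro _ _ rfl _ _ h _
    cases h
    rfl
  refine key (LooseChain.append_assoc ps qs rs).symm _ _ ?_ _
  have key2 : ∀ {ts ts'} (e : ts = ps.append (qs.append rs)) (e' : ts' = ps.append (qs.append rs)),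
      HEq (CellChain.cons e x (.pair y t)) (CellChain.cons e' x (.pair y t)) := by
    rintro _ _ rfl rfl; rfl
  exact key2 _ _

/-- Precomposition of the last member of the top with a 2-cell. -/
def lastComp {A A' A'' B' D : V} (ps : Weight A' A) {rs : Weight A'' A'} {k : A'' ⟶ B'}
    {q : Loose B' A'} {f : A ⟶ D} {D' : V} {h : B' ⟶ D'} {s : Loose D' D} {l : A'' ⟶ D'}
    (t : Cell (𝟙 A') rs k q) (φ : Cell f (ps.append (.single q)) h s) (hl : k ≫ h = l) :
    Cell f (ps.append rs) l s :=
  compRow ((ids ps).append (.single t)) φ (Category.id_comp f) hl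

theorem lastComp_comp1 {A A' A'' B' D D' F F' : V} (ps : Weight A' A) {rs : Weight A'' A'}
    {k : A'' ⟶ B'} {q : Loose B' A'} {f : A ⟶ D} {h : B' ⟶ D'} {s : Loose D' D} {l : A'' ⟶ D'}
    (t : Cell (𝟙 A') rs k q) (φ : Cell f (ps.append (.single q)) h s) (hl : k ≫ h = l)
    {f' : D ⟶ F} {h' : D' ⟶ F'} {s' : Loose F' F} (κ : Cell f' (.single s) h' s')
    {a : A ⟶ F} {b : B' ⟶ F'} {c : A'' ⟶ F'} (ha : f ≫ f' = a) (hb : h ≫ h' = b)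
    (hc : l ≫ h' = c) (hc' : k ≫ b = c) :
    lastComp ps t (comp1 φ κ ha hb) hc' = comp1 (lastComp ps t φ hl) κ ha hc :=
  compRow_comp1 _ _ _ _ _ _ _ _ _ _ _

theorem lastComp_comp2 {A A' A'' B' D D' F D'' F'' : V} (ps : Weight A' A) {rs : Weight A'' A'}
    {k : A'' ⟶ B'} {q : Loose B' A'} {f : A ⟶ D} {g : A' ⟶ D'} {h : B' ⟶ D''} {s : Loose D' D}
    {s' : Loose D'' D'} {l : A'' ⟶ D''}
    (t : Cell (𝟙 A') rs k q) (x : Cell f ps g s) (y : Cell g (.single q) h s') (hl : k ≫ h = l)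
    {f' : D ⟶ F} {h' : D'' ⟶ F''} {r : Loose F'' F} (κ : Cell f' (.cons s (.single s')) h' r)
    {a : A ⟶ F} {b : B' ⟶ F''} {c : A'' ⟶ F''} (ha : f ≫ f' = a) (hb : h ≫ h' = b)
    (hc : l ≫ h' = c) (hc' : k ≫ b = c) :
    lastComp ps t (comp2 x y κ ha hb) hc' =
      comp2 x (comp1 t y (Category.id_comp g) hl) κ ha hc := by
  refine (compRow_comp2 (ids ps) (.single t) x y κ _ _ _ _ (Category.id_comp f)
    (Category.id_comp g) hl ha hc).trans ?_
  rw [compRow_ids]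
  rfl

theorem lastComp_id {A A' B' D D' : V} (ps : Weight A' A) {q : Loose B' A'} {f : A ⟶ D}
    {h : B' ⟶ D'} {s : Loose D' D} (φ : Cell f (ps.append (.single q)) h s) :
    lastComp ps (idCell q) φ (Category.id_comp h) = φ := by
  have : ∀ {X Y Z : V} (ps : Weight Y Z) (qs : Weight X Y),
      (ids ps).append (ids qs) = ids (ps.append qs) := by
    intro X Y Z ps qs
    induction ps with
    | nil => rfl
    | cons p ps ih =>
      exact congrArg (fun Θ => (CellChain.cons rfl (idCell p) Θ :
        CellChain Cell (𝟙 _) (.cons p (ps.append qs)) _ (.cons p (ps.append qs)))) ih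
  exact (congrArg (fun Θ => compRow Θ φ (Category.id_comp f) (Category.id_comp h))
    (this ps (.single q))).trans (compRow_ids φ _ _)

theorem lastComp_lastComp {A A' A'' D B E : V} (ps : Weight A' A)
    {rs : Weight A'' A'} {q : Loose A'' A'} {q' : Loose B A'} {k : A'' ⟶ B} {f : A ⟶ D}
    {h : B ⟶ E} {s : Loose E D} {l : A'' ⟶ E}
    (t : Glob rs q) (t' : Cell (𝟙 A') (.single q) k q')
    (φ : Cell f (ps.append (.single q')) h s) (hl : k ≫ h = l) :
    lastComp ps t (lastComp ps t' φ hl) (Category.id_comp l) =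
      lastComp ps (comp1 t t' (Category.id_comp _) (Category.id_comp _)) φ hl := by
  have hids : ∀ {X Y : V} (ps : Weight X Y) {Z : V} {rs : Weight Z X} {q : Loose Z X} {q' : Loose B X}
      {k : Z ⟶ B} (t : Glob rs q) (t' : Cell (𝟙 X) (.single q) k q'),
      Stack ((ids ps).append (.single t)) ((ids ps).append (.single t'))
        ((ids ps).append (.single (comp1 t t' (Category.id_comp _) (Category.id_comp _)))) := by
    intro X Y ps Z rs q q' k t t'
    induction ps with
    | nil =>
      have H := Stack.cons (LooseChain.append_nil rs).symm (LooseChain.append_nil _).symm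
        (Category.id_comp _) (Category.id_comp _) (.single t) t' (Stack.nil (𝟙 Z) k (Category.id_comp _))
      rw [CellChain.appendOf_nil] at H
      exact H
    | cons p ps ih =>
      have H := Stack.cons (rfl : (LooseChain.cons p (ps.append rs)) = (LooseChain.single p).append _)
        (rfl : LooseChain.cons p (ps.append (.single q)) = (LooseChain.single p).append _)
        (Category.id_comp (𝟙 _)) (Category.id_comp (𝟙 _)) (.single (idCell p)) (idCell p) ih
      rw [show compRow (CellChain.single (idCell p)) (idCell p) (Category.id_comp (𝟙 _))
        (Category.id_comp (𝟙 _)) = idCell p from compRow_ids _ _ _] at H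
      exact H
  exact (hids ps t t').compRow φ _ _ _ _ _ _

end Composites

/-! ### Unit laws and actions of 2-cells into loose-identities -/

section Actions

variable {V : Type u} [VirtualDoubleCategory.{u, v, w, z} V] [VirtualEquipment V]

/-- Opcartesianness of the unit: inserting it into a loose-identity of the top loses no information.
The unitor identities below are checked in this way. -/
theorem unit_ext {A' X A B B' : V} (ps : Weight X A) (rs : Weight A' X) {f : A ⟶ B} {g : A' ⟶ B'}
    {s : Loose B' B} {ψ ψ' : Cell f (ps.append (.cons (looseId X) rs)) g s}
    (h : compRow ((ids ps).append (.cons rfl (unit X) (ids rs))) ψ (Category.id_comp f)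
        (Category.id_comp g) =
      compRow ((ids ps).append (.cons rfl (unit X) (ids rs))) ψ' (Category.id_comp f)
        (Category.id_comp g)) : ψ = ψ' :=
  (unit_opcartesian X ps rs f g s _).unique h rfl

theorem unit_leftUnitor {A B : V} (p : Loose A B) (h : 𝟙 B ≫ 𝟙 B = 𝟙 B) (h' : 𝟙 A ≫ 𝟙 A = 𝟙 A) :
    compRow (CellChain.pair (unit B) (idCell p)) (leftUnitor p) h h' = idCell p :=
  (unit_opcartesian B .nil (.single p) (𝟙 B) (𝟙 A) p (idCell p)).choose_spec.1

theorem unit_rightUnitor {A B : V} (p : Loose A B) (h : 𝟙 B ≫ 𝟙 B = 𝟙 B) (h' : 𝟙 A ≫ 𝟙 A = 𝟙 A) :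
    compRow (CellChain.pair (idCell p) (unit A)) (rightUnitor p) h h' = idCell p :=
  (unit_opcartesian A (.single p) .nil (𝟙 B) (𝟙 A) p (idCell p)).choose_spec.1

theorem unit_looseIdMap {A B : V} (f : A ⟶ B) :
    comp1 (unit A) (looseIdMap f) (Category.id_comp f) (Category.id_comp f) = tightOne f :=
  (unit_opcartesian A .nil .nil f f (looseId B) (tightOne f)).choose_spec.1

theorem tightOne_id (A : V) : tightOne (𝟙 A) = unit A :=
  compRow_ids (unit A) _ _

theorem looseIdMap_id (A : V) : looseIdMap (𝟙 A) = idCell (looseId A) := by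
  refine unit_ext .nil .nil ?_
  refine (unit_looseIdMap (𝟙 A)).trans ((tightOne_id A).trans ?_)
  exact (comp1_id (unit A) _ _).symm

/-- The action on the left of a 2-cell into a loose-identity. -/
noncomputable def lact {A A' A'' X W : V} {f : A ⟶ X} {ps : Weight A' A} {c : A' ⟶ X}
    {qs : Weight A'' A'} {h : A'' ⟶ W} {p : Loose W X} (u : Cell f ps c (looseId X))
    (y : Cell c qs h p) : Cell f (ps.append qs) h p :=
  comp2 u y (leftUnitor p) (Category.comp_id f) (Category.comp_id h)

/-- The action on the right of a 2-cell into a loose-identity. -/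
noncomputable def ract {A A' A'' X W : V} {f : A ⟶ X} {ps : Weight A' A} {c : A' ⟶ W}
    {qs : Weight A'' A'} {h : A'' ⟶ W} {p : Loose W X} (x : Cell f ps c p)
    (u : Cell c qs h (looseId W)) : Cell f (ps.append qs) h p :=
  comp2 x u (rightUnitor p) (Category.comp_id f) (Category.comp_id h)

theorem tightOne_lact {A A'' X W : V} {f : A ⟶ X} {qs : Weight A'' A} {h : A'' ⟶ W}
    {p : Loose W X} (y : Cell f qs h p) : lact (tightOne f) y = y := by
  have e := compRow_comp2 (.nil f) (.single y) (unit X) (idCell p) (leftUnitor p)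
    (Category.id_comp _) (Category.id_comp _) (Category.comp_id f) (Category.comp_id h)
    (Category.comp_id f) (Category.comp_id f) (Category.comp_id h) (Category.comp_id f)
    (Category.comp_id h)
  rw [show comp2 (unit X) (idCell p) (leftUnitor p) _ _ = idCell p from unit_leftUnitor p _ _] at e
  have e' := e.symm.trans (comp1_id y (Category.comp_id f) (Category.comp_id h))
  change comp2 (tightOne f) (comp1 y (idCell p) (Category.comp_id f) (Category.comp_id h))
    (leftUnitor p) (Category.comp_id f) (Category.comp_id h) = y at e'
  rwa [comp1_id] at e'

theorem unit_lact {A' X W : V} {qs : Weight A' X} {h : A' ⟶ W}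
    {p : Loose W X} (y : Cell (𝟙 X) qs h p) : lact (unit X) y = y := by
  rw [← tightOne_id, tightOne_lact]

/-- Heterogeneous, unlike `tightOne_lact`, because `ps.append .nil` does not reduce to `ps`. -/
theorem ract_tightOne {A A' X W : V} {f : A ⟶ X} {ps : Weight A' A} {h : A' ⟶ W}
    {p : Loose W X} (x : Cell f ps h p) : HEq (ract x (tightOne h)) x := by
  have e := compRow_comp2 (.single x) (.nil h) (idCell p) (unit W) (rightUnitor p)
    (Category.id_comp _) (Category.id_comp _) (Category.comp_id f) (Category.comp_id h)
    (Category.comp_id f) (Category.comp_id h) (Category.comp_id h) (Category.comp_id f)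
    (Category.comp_id h)
  rw [show comp2 (idCell p) (unit W) (rightUnitor p) _ _ = idCell p from
    unit_rightUnitor p _ _] at e
  change _ = comp2 (comp1 x (idCell p) (Category.comp_id f) (Category.comp_id h)) (tightOne h)
    (rightUnitor p) (Category.comp_id f) (Category.comp_id h) at e
  rw [comp1_id] at e
  refine (heq_of_eq e.symm).trans (HEq.trans ?_ (heq_of_eq (comp1_id x (Category.comp_id f)
    (Category.comp_id h))))
  have key : ∀ {ts} (hts : ts = ps.append .nil),
      HEq (compRow (CellChain.cons hts x (.nil h) : CellChain Cell f ts h (.single p)) (idCell p)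
        (Category.comp_id f) (Category.comp_id h))
      (compRow (CellChain.cons rfl x (.nil h) : CellChain Cell f (ps.append .nil) h (.single p))
        (idCell p) (Category.comp_id f) (Category.comp_id h)) := by
    rintro _ rfl; rfl
  exact (key (LooseChain.append_nil ps).symm).symm

/-- Naturality of the unitor: inserting the unit reduces both sides to `κ`. -/
theorem leftUnitor_comp1 {A B D D' : V} {q : Loose A B} {g : B ⟶ D} {h : A ⟶ D'} {q' : Loose D' D}
    (κ : Cell g (.single q) h q') (h₁ : 𝟙 B ≫ g = g) (h₂ : 𝟙 A ≫ h = h) (h₃ : g ≫ 𝟙 D = g)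
    (h₄ : h ≫ 𝟙 D' = h) :
    comp1 (leftUnitor q) κ h₁ h₂ = comp2 (looseIdMap g) κ (leftUnitor q') h₃ h₄ := by
  refine unit_ext .nil (.single q) ?_
  refine (compRow_comp1 _ _ _ _ _ _ _ (Category.id_comp _) (Category.id_comp _)
    (Category.id_comp g) (Category.id_comp h)).trans ?_
  refine (congrArg (fun x => comp1 x κ _ _) (unit_leftUnitor q _ _)).trans ?_
  refine (id_comp1 κ _ _).trans (Eq.symm ?_)
  refine (compRow_comp2 (.single (unit B)) (ids (.single q)) (looseIdMap g) κ (leftUnitor q')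
    _ _ _ _ (Category.id_comp g) (Category.id_comp g) (Category.id_comp h)
    (Category.comp_id g) (Category.comp_id h)).trans ?_
  rw [compRow_ids]
  refine (congrArg (fun x => comp2 x κ _ _ _) (unit_looseIdMap g)).trans ?_
  exact tightOne_lact κ

theorem rightUnitor_comp1 {A B D D' : V} {q : Loose A B} {g : B ⟶ D} {h : A ⟶ D'} {q' : Loose D' D}
    (κ : Cell g (.single q) h q') (h₁ : 𝟙 B ≫ g = g) (h₂ : 𝟙 A ≫ h = h) (h₃ : g ≫ 𝟙 D = g)
    (h₄ : h ≫ 𝟙 D' = h) :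
    comp1 (rightUnitor q) κ h₁ h₂ = comp2 κ (looseIdMap h) (rightUnitor q') h₃ h₄ := by
  refine unit_ext (.single q) .nil ?_
  refine (compRow_comp1 _ _ _ _ _ _ _ (Category.id_comp _) (Category.id_comp _)
    (Category.id_comp g) (Category.id_comp h)).trans ?_
  refine (congrArg (fun x => comp1 x κ _ _) (unit_rightUnitor q _ _)).trans ?_
  refine (id_comp1 κ _ _).trans (Eq.symm ?_)
  refine (compRow_comp2 (ids (.single q)) (.single (unit A)) κ (looseIdMap h) (rightUnitor q')
    _ _ _ _ (Category.id_comp g) (Category.id_comp h) (Category.id_comp h)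
    (Category.comp_id g) (Category.comp_id h)).trans ?_
  rw [compRow_ids]
  refine (congrArg (fun x => comp2 κ x _ _ _) (unit_looseIdMap h)).trans ?_
  exact eq_of_heq (ract_tightOne κ)

/-- With units inserted in both slots, either unitor becomes the unit of `A`. -/
theorem leftUnitor_looseId (A : V) : leftUnitor (looseId A) = rightUnitor (looseId A) := by
  refine unit_ext .nil (.single _) (unit_ext .nil .nil ?_)
  have e₁ := unit_leftUnitor (looseId A) (Category.id_comp _) (Category.id_comp _)
  refine (congrArg (fun x => comp1 (unit A) x (Category.id_comp _) (Category.id_comp _)) e₁).trans ?_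
  refine (comp1_id _ _ _).trans (Eq.symm ?_)
  have e₂ : compRow (CellChain.pair (unit A) (idCell (looseId A))) (rightUnitor (looseId A))
      (Category.id_comp _) (Category.id_comp _) = ract (unit A) (idCell _) := rfl
  refine (congrArg (fun x => comp1 (unit A) x (Category.id_comp _) (Category.id_comp _)) e₂).trans ?_
  refine (compRow_comp2 (.nil (𝟙 A)) (.single (unit A)) (unit A) (idCell (looseId A))
    (rightUnitor (looseId A)) _ _ _ _ (Category.id_comp _) (Category.id_comp _)
    (Category.id_comp _) (Category.comp_id _) (Category.comp_id _)).trans ?_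
  have h₁ : compRow (.nil (𝟙 A)) (unit A) (Category.id_comp _) (Category.id_comp _) = unit A :=
    compRow_ids _ _ _
  have h₂ : compRow (.single (unit A)) (idCell (looseId A)) (Category.id_comp _)
    (Category.id_comp _) = unit A := comp1_id _ _ _
  rw [h₁, h₂]
  have := eq_of_heq (ract_tightOne (unit A))
  rwa [tightOne_id] at this

/-- A 2-cell into the loose-identity between `p` and `q` may be absorbed on either side. It suffices
to compare the two unitors followed by `ψ`, and both give `ψ` once the unit is inserted. -/
theorem comp2_lact_heq {A₀ A₁ A₂ A₃ B₀ B₁ B₂ D D' : V}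
    {f₀ : A₀ ⟶ B₀} {f₁ : A₁ ⟶ B₁} {f₂ : A₂ ⟶ B₁} {f₃ : A₃ ⟶ B₂}
    {ps : Weight A₁ A₀} {qs : Weight A₂ A₁} {rs : Weight A₃ A₂}
    {p : Loose B₁ B₀} {q : Loose B₂ B₁} (x : Cell f₀ ps f₁ p)
    (u : Cell f₁ qs f₂ (looseId B₁)) (y : Cell f₂ rs f₃ q) {m : B₀ ⟶ D} {n : B₂ ⟶ D'}
    {s : Loose D' D} (ψ : Cell m (.cons p (.single q)) n s) {e : A₀ ⟶ D} {e' : A₃ ⟶ D'}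
    (he : f₀ ≫ m = e) (he' : f₃ ≫ n = e') :
    HEq (comp2 x (lact u y) ψ he he') (comp2 (ract x u) y ψ he he') := by
  have h : comp2 (idCell p) (leftUnitor q) ψ (Category.id_comp m) (Category.id_comp n) =
      comp2 (rightUnitor p) (idCell q) ψ (Category.id_comp m) (Category.id_comp n) := by
    refine unit_ext (.single p) (.single q) ?_
    refine (compRow_comp2 (ids (.single p)) (.pair (unit B₁) (idCell q)) (idCell p) (leftUnitor q)
      ψ _ _ _ _ (Category.id_comp _) (Category.id_comp _) (Category.id_comp _)
      (Category.id_comp m) (Category.id_comp n)).trans ?_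
    refine Eq.trans ?_ (compRow_comp2 (.pair (idCell p) (unit B₁)) (ids (.single q)) (rightUnitor p)
      (idCell q) ψ _ _ _ _ (Category.id_comp _) (Category.id_comp _) (Category.id_comp _)
      (Category.id_comp m) (Category.id_comp n)).symm
    rw [unit_leftUnitor, unit_rightUnitor, compRow_ids, compRow_ids]
    rfl
  have := comp2_right_eq_left x u y h (Category.comp_id f₀) (Category.comp_id f₁)
    (Category.comp_id f₂) (Category.comp_id f₃) (Category.comp_id f₀) (Category.comp_id f₃)
    he he' he he'
  rwa [comp1_id, comp1_id] at this

theorem lact_comp2_heq {A₀ A₁ A₂ A₃ B₀ B₁ B₂ D' : V}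
    {f₀ : A₀ ⟶ B₀} {f₁ : A₁ ⟶ B₀} {f₂ : A₂ ⟶ B₁} {f₃ : A₃ ⟶ B₂}
    {ps : Weight A₁ A₀} {qs : Weight A₂ A₁} {rs : Weight A₃ A₂}
    {p : Loose B₁ B₀} {q : Loose B₂ B₁} (u : Cell f₀ ps f₁ (looseId B₀))
    (x : Cell f₁ qs f₂ p) (y : Cell f₂ rs f₃ q) {n : B₂ ⟶ D'}
    {s : Loose D' B₀} (ψ : Cell (𝟙 B₀) (.cons p (.single q)) n s) {e' : A₃ ⟶ D'}
    (he₀ : f₀ ≫ 𝟙 _ = f₀) (he : f₁ ≫ 𝟙 _ = f₁) (he' : f₃ ≫ n = e') :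
    HEq (lact u (comp2 x y ψ he he')) (comp2 (lact u x) y ψ he₀ he') := by
  have h : comp2 (idCell (looseId B₀)) ψ (leftUnitor s) (Category.id_comp _) (Category.comp_id n) =
      comp2 (leftUnitor p) (idCell q) ψ (Category.id_comp _) (Category.id_comp n) := by
    refine unit_ext .nil (.cons p (.single q)) ?_
    refine (compRow_comp2 (.single (unit B₀)) (ids (.cons p (.single q))) (idCell _) ψ
      (leftUnitor s) _ _ _ _ (Category.id_comp _) (Category.id_comp _) (Category.id_comp n)
      (Category.id_comp _) (Category.comp_id n)).trans ?_
    refine Eq.trans ?_ (compRow_comp2 (.pair (unit B₀) (idCell p)) (ids (.single q)) (leftUnitor p)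
      (idCell q) ψ _ _ _ _ (Category.id_comp _) (Category.id_comp _) (Category.id_comp _)
      (Category.id_comp _) (Category.id_comp n)).symm
    rw [unit_leftUnitor, compRow_ids, compRow_ids]
    refine Eq.trans ?_ (id_comp2 ψ _ _).symm
    refine Eq.trans ?_ (unit_lact ψ)
    exact congrArg (fun x => comp2 x ψ (leftUnitor s) _ _) (comp1_id (unit B₀) _ _)
  have := comp2_right_eq_left u x y h (Category.comp_id f₀) (Category.comp_id f₁)
    (Category.comp_id f₂) he' (Category.comp_id f₀) (Category.comp_id f₃) he₀ (Category.comp_id e')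
    he₀ he'
  rwa [comp1_id, comp1_id] at this

end Actions

/-- Transports universal properties: `P` and `Q` will be composition with cartesian or invertible
2-cells, and the square an associativity law. -/
theorem bijective_iff_of_square {α β γ δ : Type*} {F : α → β} {G : γ → δ} {P : α → γ} {Q : β → δ}
    (hP : Function.Bijective P) (hQ : Function.Bijective Q) (h : ∀ x, Q (F x) = G (P x)) :
    Function.Bijective F ↔ Function.Bijective G := by
  rw [← Function.Bijective.of_comp_iff G hP, ← Function.Bijective.of_comp_iff' hQ F]
  rw [show Q ∘ F = G ∘ P from funext h]

/-! ### Compatibility of actions with composition -/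

section ActionLemmas

variable {V : Type u} [VirtualDoubleCategory.{u, v, w, z} V] [VirtualEquipment V]

theorem lact_comp1 {A A' A'' X W D D' : V} {f : A ⟶ X} {ps : Weight A' A} {c : A' ⟶ X}
    {qs : Weight A'' A'} {h : A'' ⟶ W} {p : Loose W X} (u : Cell f ps c (looseId X))
    (y : Cell c qs h p) {g : X ⟶ D} {h' : W ⟶ D'} {p' : Loose D' D} (κ : Cell g (.single p) h' p')
    {k : A ⟶ D} {m : A' ⟶ D} {l : A'' ⟶ D'} (hk : f ≫ g = k) (hm : c ≫ g = m) (hl : h ≫ h' = l) :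
    comp1 (lact u y) κ hk hl = lact (comp1 u (looseIdMap g) hk hm) (comp1 y κ hm hl) := by
  refine (comp2_comp1 u y (leftUnitor p) κ (Category.id_comp g) (Category.id_comp h') hk hl
    (Category.comp_id f) (Category.comp_id h) hk hl).symm.trans ?_
  rw [leftUnitor_comp1 κ _ _ (Category.comp_id g) (Category.comp_id h')]
  exact comp2_comp2 _ _ _ _ _ _ _ _ _ _ _ _ _ _

theorem lact_comp1_of_id {A A' A'' X W D' : V} {f : A ⟶ X} {ps : Weight A' A} {c : A' ⟶ X}
    {qs : Weight A'' A'} {h : A'' ⟶ W} {p : Loose W X} (u : Cell f ps c (looseId X))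
    (y : Cell c qs h p) {h' : W ⟶ D'} {p' : Loose D' X} (κ : Cell (𝟙 X) (.single p) h' p')
    {l : A'' ⟶ D'} (hk : f ≫ 𝟙 X = f) (hm : c ≫ 𝟙 X = c) (hl : h ≫ h' = l) :
    comp1 (lact u y) κ hk hl = lact u (comp1 y κ hm hl) := by
  rw [lact_comp1 u y κ hk hm hl, looseIdMap_id, comp1_id]

theorem ract_comp1 {A A' A'' X W D D' : V} {f : A ⟶ X} {ps : Weight A' A} {c : A' ⟶ W}
    {qs : Weight A'' A'} {h : A'' ⟶ W} {p : Loose W X} (x : Cell f ps c p)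
    (u : Cell c qs h (looseId W)) {g : X ⟶ D} {h' : W ⟶ D'} {p' : Loose D' D}
    (κ : Cell g (.single p) h' p') {k : A ⟶ D} {m : A' ⟶ D'} {l : A'' ⟶ D'}
    (hk : f ≫ g = k) (hm : c ≫ h' = m) (hl : h ≫ h' = l) :
    comp1 (ract x u) κ hk hl = ract (comp1 x κ hk hm) (comp1 u (looseIdMap h') hm hl) := by
  refine (comp2_comp1 x u (rightUnitor p) κ (Category.id_comp g) (Category.id_comp h') hk hl
    (Category.comp_id f) (Category.comp_id h) hk hl).symm.trans ?_
  rw [rightUnitor_comp1 κ _ _ (Category.comp_id g) (Category.comp_id h')]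
  exact comp2_comp2 _ _ _ _ _ _ _ _ _ _ _ _ _ _

theorem ract_comp1_of_id {A A' A'' X W D : V} {f : A ⟶ X} {ps : Weight A' A} {c : A' ⟶ W}
    {qs : Weight A'' A'} {h : A'' ⟶ W} {p : Loose W X} (x : Cell f ps c p)
    (u : Cell c qs h (looseId W)) {g : X ⟶ D} {p' : Loose W D} (κ : Cell g (.single p) (𝟙 W) p')
    {k : A ⟶ D} (hk : f ≫ g = k) (hm : c ≫ 𝟙 W = c) (hl : h ≫ 𝟙 W = h) :
    comp1 (ract x u) κ hk hl = ract (comp1 x κ hk hm) u := by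
  rw [ract_comp1 x u κ hk hm hl, looseIdMap_id, comp1_id]

theorem ract_eq_lact {A A' A'' X : V} {f : A ⟶ X} {ps : Weight A' A} {c : A' ⟶ X}
    {qs : Weight A'' A'} {h : A'' ⟶ X} (x : Cell f ps c (looseId X))
    (y : Cell c qs h (looseId X)) : ract x y = lact x y := by
  simp only [ract, lact, leftUnitor_looseId]

theorem lact_tightOne {A A' X : V} {f : A ⟶ X} {ps : Weight A' A} {h : A' ⟶ X}
    (x : Cell f ps h (looseId X)) : HEq (lact x (tightOne h)) x := by
  rw [← ract_eq_lact]
  exact ract_tightOne x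

theorem lact_lact_heq {A₀ A₁ A₂ A₃ X W : V} {f₀ : A₀ ⟶ X} {f₁ : A₁ ⟶ X} {f₂ : A₂ ⟶ X} {h : A₃ ⟶ W}
    {ps : Weight A₁ A₀} {qs : Weight A₂ A₁} {rs : Weight A₃ A₂} {p : Loose W X}
    (x : Cell f₀ ps f₁ (looseId X)) (u : Cell f₁ qs f₂ (looseId X)) (y : Cell f₂ rs h p) :
    HEq (lact x (lact u y)) (lact (lact x u) y) := by
  rw [← ract_eq_lact]
  exact comp2_lact_heq x u y (leftUnitor p) _ _

theorem lact_tightComp {A A' X W : V} {f g h : A ⟶ X} {k : A' ⟶ W} {rs : Weight A' A}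
    {p : Loose W X} (α : TightTwoCell f g) (β : TightTwoCell g h) (y : Cell h rs k p) :
    lact (tightComp α β) y = lact α (lact β y) :=
  (eq_of_heq (lact_lact_heq α β y)).symm

theorem lact_congr {A A' A'' X W : V} {f : A ⟶ X} {ps ps' : Weight A' A} {c : A' ⟶ X}
    {qs : Weight A'' A'} {h : A'' ⟶ W} {p : Loose W X} (hps : ps = ps')
    {u : Cell f ps c (looseId X)} {u' : Cell f ps' c (looseId X)} (hu : HEq u u')
    (y : Cell c qs h p) : HEq (lact u y) (lact u' y) := by
  subst hps
  cases hu
  rfl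

theorem lact_lastComp {A A' A'' B W X : V} {ps : Weight A' A} {rs : Weight B A'} {k : B ⟶ A''}
    {q : Loose A'' A'} {f : A ⟶ X} {c : A' ⟶ X} {h : A'' ⟶ W} {p : Loose W X} {l : B ⟶ W}
    (u : Cell f ps c (looseId X)) (t : Cell (𝟙 A') rs k q) (y : Cell c (.single q) h p)
    (hl : k ≫ h = l) :
    lastComp ps t (lact u y) hl = lact u (comp1 t y (Category.id_comp c) hl) :=
  lastComp_comp2 ps t u y hl (leftUnitor p) _ _ _ _

theorem comp1_lact_of_nil {A A'' B W X : V} {rs : Weight B A} {k : B ⟶ A''}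
    {q : Loose A'' A} {f c : A ⟶ X} {h : A'' ⟶ W} {p : Loose W X} {l : B ⟶ W}
    (u : TightTwoCell f c) (t : Cell (𝟙 A) rs k q) (y : Cell c (.single q) h p)
    (hf : 𝟙 A ≫ f = f) (hc : 𝟙 A ≫ c = c) (hl : k ≫ h = l) :
    comp1 t (lact u y) hf hl = lact u (comp1 t y hc hl) :=
  lact_lastComp u t y hl

end ActionLemmas

/-! ### Cartesian 2-cells and conjoints -/

section Restrictions

variable {V : Type u} [VirtualDoubleCategory.{u, v, w, z} V] [VirtualEquipment V]

theorem comp1_cart_bijective {A A' B B' D D' : V} (q : Loose B' B) (f : A ⟶ B) (g : A' ⟶ B')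
    (f' : D ⟶ A) (g' : D' ⟶ A') (rs : Weight D' D) {k : D ⟶ B} {l : D' ⟶ B'}
    (hk : f' ≫ f = k) (hl : g' ≫ g = l) :
    Function.Bijective fun ψ : Cell f' rs g' (restr q f g) => comp1 ψ (cart q f g) hk hl := by
  subst hk hl
  exact (Function.bijective_iff_existsUnique _).2 fun φ => cart_cartesian q f g f' rs g' φ

theorem factor_cart {A A' B B' D D' : V} (q : Loose B' B) (f : A ⟶ B) (g : A' ⟶ B')
    (f' : D ⟶ A) (g' : D' ⟶ A') {rs : Weight D' D} {k : D ⟶ B} {l : D' ⟶ B'}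
    (hk : k = f' ≫ f) (hl : l = g' ≫ g) (φ : Cell k rs l q) (hk' : f' ≫ f = k) (hl' : g' ≫ g = l) :
    comp1 (factor q f g f' g' hk hl φ) (cart q f g) hk' hl' = φ := by
  subst hk hl
  exact (cart_cartesian q f g f' rs g' φ).choose_spec.1

theorem factorGlob_cart {A A' B B' : V} (q : Loose B' B) (f : A ⟶ B) (g : A' ⟶ B')
    {rs : Weight A' A} (φ : Cell f rs g q) (hk : 𝟙 A ≫ f = f) (hl : 𝟙 A' ≫ g = g) :
    comp1 (factorGlob q f g φ) (cart q f g) hk hl = φ :=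
  factor_cart q f g (𝟙 A) (𝟙 A') _ _ φ _ _

theorem cart_ext {A A' B B' D D' : V} {q : Loose B' B} {f : A ⟶ B} {g : A' ⟶ B'}
    {f' : D ⟶ A} {g' : D' ⟶ A'} {rs : Weight D' D} {k : D ⟶ B} {l : D' ⟶ B'}
    (hk : f' ≫ f = k) (hl : g' ≫ g = l) {ψ ψ' : Cell f' rs g' (restr q f g)}
    (h : comp1 ψ (cart q f g) hk hl = comp1 ψ' (cart q f g) hk hl) : ψ = ψ' :=
  (comp1_cart_bijective q f g f' g' rs hk hl).1 h

theorem conjointUnit_cart {A B : V} (f : A ⟶ B) (h : 𝟙 A ≫ f = f) (h' : f ≫ 𝟙 B = f) :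
    comp1 (conjointUnit f) (cart (looseId B) f (𝟙 B)) h h' = tightOne f :=
  factor_cart _ _ _ _ _ _ _ _ _ _

/-- Zigzag identity for the conjoint; after composing with the cartesian 2-cell it is the unit law
for the action of the identity on `f`. -/
theorem ract_conjointUnit_cart {A B : V} (f : A ⟶ B) :
    ract (conjointUnit f) (cart (looseId B) f (𝟙 B)) = idCell (conjoint f) := by
  refine cart_ext (Category.id_comp f) (Category.id_comp _) ?_
  refine (ract_comp1_of_id _ _ _ _ (Category.comp_id f) _).trans ?_
  refine Eq.trans ?_ (id_comp1 _ _ _).symm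
  rw [conjointUnit_cart, ract_eq_lact, tightOne_lact]

end Restrictions

/-! ### Invertible 2-cells and uniqueness of right lifts -/

section Invertible

variable {V : Type u} [VirtualDoubleCategory.{u, v, w, z} V]

theorem IsInvertible.comp1_bijective {X Y B B' : V} {p q : Loose X Y} {α : Glob (.single p) q}
    (hα : IsInvertible α) (f : B ⟶ Y) (g : B' ⟶ X) (rs : Weight B' B) :
    Function.Bijective fun ψ : Cell f rs g p =>
      comp1 ψ α (Category.comp_id f) (Category.comp_id g) := by
  obtain ⟨β, h₁, h₂⟩ := hα
  refine Function.bijective_iff_has_inverse.2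
    ⟨fun ψ => comp1 ψ β (Category.comp_id f) (Category.comp_id g), fun ψ => ?_, fun ψ => ?_⟩
  · refine (comp1_assoc ψ α β (Category.id_comp _) (Category.id_comp _) (Category.comp_id f)
      (Category.comp_id g) _ _ _ _).symm.trans ?_
    exact (congrArg (fun x => comp1 ψ x _ _) h₁).trans (comp1_id ψ _ _)
  · refine (comp1_assoc ψ β α (Category.id_comp _) (Category.id_comp _) (Category.comp_id f)
      (Category.comp_id g) _ _ _ _).symm.trans ?_
    exact (congrArg (fun x => comp1 ψ x _ _) h₂).trans (comp1_id ψ _ _)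

theorem isInvertible_idCell {X Y : V} (p : Loose X Y) : IsInvertible (idCell p) :=
  ⟨idCell p, comp1_id _ _ _, comp1_id _ _ _⟩

/-- The Yoneda argument; unary domains are enough. -/
theorem isInvertible_of_bijective {X Y : V} {p q : Loose X Y} {α : Glob (.single p) q}
    (h : ∀ r : Loose X Y, Function.Bijective fun t : Glob (.single r) p =>
      comp1 t α (Category.id_comp _) (Category.id_comp _)) : IsInvertible α := by
  obtain ⟨β, hβ⟩ := (h q).2 (idCell q)
  refine ⟨β, (h p).1 ?_, hβ⟩
  refine (comp1_assoc α β α (Category.id_comp _) (Category.id_comp _) (Category.id_comp _)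
    (Category.id_comp _) _ _ _ _).symm.trans ?_
  refine (congrArg (fun x => comp1 α x _ _) hβ).trans ?_
  exact (comp1_id _ _ _).trans (id_comp1 _ _ _).symm

theorem LooseIso.refl {X Y : V} (p : Loose X Y) : LooseIso p p := ⟨_, isInvertible_idCell p⟩

theorem LooseIso.symm {X Y : V} {p q : Loose X Y} : LooseIso p q → LooseIso q p :=
  fun ⟨α, β, h, h'⟩ => ⟨β, α, h', h⟩

theorem isRightLift_iff {X Y Z : V} {ps : Weight Y Z} {q : Loose X Z} {l : Loose X Y}
    {ϖ : Glob (ps.append (.single l)) q} :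
    IsRightLift ps q l ϖ ↔ ∀ rs : Weight X Y, Function.Bijective fun ψ : Glob rs l =>
      lastComp ps ψ ϖ (Category.id_comp _) :=
  forall_congr' fun _ => (Function.bijective_iff_existsUnique _).symm

theorem IsRightLift.comp1 {X Y Z : V} {ps : Weight Y Z} {q q' : Loose X Z} {l : Loose X Y}
    {ϖ : Glob (ps.append (.single l)) q} (h : IsRightLift ps q l ϖ) {α : Glob (.single q) q'}
    (hα : IsInvertible α) :
    IsRightLift ps q' l (comp1 ϖ α (Category.comp_id _) (Category.comp_id _)) := by
  rw [isRightLift_iff] at h ⊢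
  intro rs
  convert (hα.comp1_bijective (𝟙 Z) (𝟙 X) (ps.append rs)).comp (h rs) using 2 with ψ
  exact lastComp_comp1 _ _ _ _ _ _ _ _ _

theorem IsRightLift.exists_iso {X Y Z : V} {ps : Weight Y Z} {q : Loose X Z} {l l' : Loose X Y}
    {ϖ : Glob (ps.append (.single l)) q} {ϖ' : Glob (ps.append (.single l')) q}
    (h : IsRightLift ps q l ϖ) (h' : IsRightLift ps q l' ϖ') : LooseIso l l' := by
  rw [isRightLift_iff] at h h'
  obtain ⟨α, hα⟩ := (h' _).2 ϖ
  obtain ⟨β, hβ⟩ := (h _).2 ϖ'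
  refine ⟨α, β, (h _).1 ?_, (h' _).1 ?_⟩
  · refine (lastComp_lastComp ps α β ϖ _).symm.trans ?_
    exact (congrArg (fun x => lastComp ps α x (Category.id_comp _)) hβ).trans
      (hα.trans (lastComp_id ps ϖ).symm)
  · refine (lastComp_lastComp ps β α ϖ' _).symm.trans ?_
    exact (congrArg (fun x => lastComp ps β x (Category.id_comp _)) hα).trans
      (hβ.trans (lastComp_id ps ϖ').symm)

end Invertible

/-! ### Colimits, preservation and respect as bijective actions -/

section Exhibits

variable {V : Type u} [VirtualDoubleCategory.{u, v, w, z} V] [VirtualEquipment V]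

/-- Every 2-cell `ps, rs ⇒ p` with left side `f` and right side `1` factors uniquely through `u`.
For a cocone `(c, γ)` and the corresponding 2-cell `u` into `X(1, 1)`, this says that `p` respects
the cocone. -/
def Exhibits {W X Y Z : V} (p : Loose W X) {ps : Weight Y Z} {f : Z ⟶ X} {c : Y ⟶ X}
    (u : Cell f ps c (looseId X)) : Prop :=
  ∀ rs : Weight W Y, Function.Bijective fun ψ : Cell c rs (𝟙 W) p => lact u ψ

theorem action_cart {W X Y Z : V} (p : Loose W X) (g : Z ⟶ X) (c : Y ⟶ X)
    (hk : 𝟙 Z ≫ g = g) (hl : 𝟙 W ≫ 𝟙 W = 𝟙 W) :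
    comp1 (action p g c) (cart p g (𝟙 W)) hk hl =
      lact (cart (looseId X) g c) (cart p c (𝟙 W)) :=
  factorGlob_cart _ _ _ _ _ _

/-- Composing with the cartesian 2-cells of `p(c, 1)` and `p(f, 1)` removes both restrictions and
turns factorisation through the canonical 2-cell into the action of the transpose of `γ`. -/
theorem respects_iff {W X Y Z : V} (p : Loose W X) {ps : Weight Y Z} (f : Z ⟶ X) (c : Y ⟶ X)
    (γ : Glob ps (hom f c)) :
    Respects p f c γ ↔
      Exhibits p (comp1 γ (cart (looseId X) f c) (Category.id_comp f) (Category.id_comp c)) := by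
  refine isRightLift_iff.trans (forall_congr' fun rs => ?_)
  refine bijective_iff_of_square
    (comp1_cart_bijective p c (𝟙 W) (𝟙 Y) (𝟙 W) rs (Category.id_comp c) (Category.id_comp _))
    (comp1_cart_bijective p f (𝟙 W) (𝟙 Z) (𝟙 W) _ (Category.id_comp f) (Category.id_comp _))
    fun ψ => ?_
  have e : lastComp ps ψ (coconeAction γ p) (Category.id_comp _) =
      comp2 γ ψ (action p f c) (Category.id_comp _) (Category.id_comp _) := by
    refine (lastComp_comp2 ps ψ γ (idCell _) (Category.comp_id _) (action p f c) _ _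
      (Category.id_comp _) _).trans ?_
    exact congrArg (fun x => comp2 γ x (action p f c) _ _) (comp1_id ψ _ _)
  refine (congrArg (fun x => comp1 x _ _ _) e).trans ?_
  refine (comp2_comp1 _ _ _ _ (Category.id_comp f) (Category.id_comp _) (Category.id_comp f)
    (Category.id_comp _) _ _ _ _).symm.trans ?_
  rw [action_cart]
  exact comp2_comp2 _ _ _ _ _ _ _ _ _ _ _ _ _ _

theorem isColimit_iff {X Y Z : V} {ps : Weight Y Z} (f : Z ⟶ X) (c : Y ⟶ X)
    (γ : Glob ps (hom f c)) :
    IsColimit f c γ ↔ Exhibits (looseId X)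
      (comp1 γ (cart (looseId X) f c) (Category.id_comp f) (Category.id_comp c)) :=
  respects_iff (looseId X) f c γ

/-- 2-cells into `p(g, 1)` are 2-cells into `p` with `g` composed on the left side, and `lact_comp1`
matches the two actions. Preservation thereby becomes a case of respect. -/
theorem exhibits_restr_iff {W X X' Y Z : V} (p : Loose W X') (g : X ⟶ X') {ps : Weight Y Z}
    {f : Z ⟶ X} {c : Y ⟶ X} (u : Cell f ps c (looseId X)) {k : Z ⟶ X'} {m : Y ⟶ X'}
    (hk : f ≫ g = k) (hm : c ≫ g = m) :
    Exhibits (restr p g (𝟙 W)) u ↔ Exhibits p (comp1 u (looseIdMap g) hk hm) :=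
  forall_congr' fun rs => bijective_iff_of_square
    (comp1_cart_bijective p g (𝟙 W) c (𝟙 W) rs hm (Category.id_comp _))
    (comp1_cart_bijective p g (𝟙 W) f (𝟙 W) _ hk (Category.id_comp _))
    fun ψ => lact_comp1 u ψ (cart p g (𝟙 W)) hk hm (Category.id_comp _)

theorem coconeMap_cart {X X' Y Z : V} {ps : Weight Y Z} {f : Z ⟶ X} {c : Y ⟶ X}
    (γ : Glob ps (hom f c)) (g : X ⟶ X') (hk : 𝟙 Z ≫ f ≫ g = f ≫ g) (hl : 𝟙 Y ≫ c ≫ g = c ≫ g) :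
    comp1 (coconeMap γ g) (cart (looseId X') (f ≫ g) (c ≫ g)) hk hl =
      comp1 (comp1 γ (cart (looseId X) f c) (Category.id_comp f) (Category.id_comp c))
        (looseIdMap g) rfl rfl :=
  factorGlob_cart _ _ _ _ _ _

theorem respects_restr_iff {W X X' Y Z : V} (p : Loose W X') (g : X ⟶ X') {ps : Weight Y Z}
    (f : Z ⟶ X) (c : Y ⟶ X) (γ : Glob ps (hom f c)) :
    Respects (restr p g (𝟙 W)) f c γ ↔ Respects p (f ≫ g) (c ≫ g) (coconeMap γ g) := by
  rw [respects_iff, respects_iff, coconeMap_cart, exhibits_restr_iff]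

theorem preserves_iff_respects {X X' Y Z : V} (g : X ⟶ X') {ps : Weight Y Z}
    (f : Z ⟶ X) (c : Y ⟶ X) (γ : Glob ps (hom f c)) :
    Preserves g f c γ ↔ Respects (conjoint g) f c γ :=
  (respects_restr_iff (looseId X') g f c γ).symm

theorem Exhibits.of_looseIso {W X Y Z : V} {p p' : Loose W X} {ps : Weight Y Z} {f : Z ⟶ X}
    {c : Y ⟶ X} {u : Cell f ps c (looseId X)} (h : Exhibits p u) (e : LooseIso p p') :
    Exhibits p' u := by
  obtain ⟨α, hα⟩ := e
  exact fun rs => (bijective_iff_of_square (hα.comp1_bijective c (𝟙 W) rs)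
    (hα.comp1_bijective f (𝟙 W) _)
    fun ψ => lact_comp1_of_id u ψ α _ _ _).1 (h rs)

theorem IsTightInvertible.lact_bijective {A B X W : V} {f g : A ⟶ X} {σ : TightTwoCell f g}
    (hσ : IsTightInvertible σ) (rs : Weight B A) (h : B ⟶ W) (p : Loose W X) :
    Function.Bijective fun ψ : Cell g rs h p => (lact σ ψ : Cell f rs h p) := by
  obtain ⟨τ, h₁, h₂⟩ := hσ
  refine Function.bijective_iff_has_inverse.2 ⟨fun ψ => lact τ ψ, fun ψ => ?_, fun ψ => ?_⟩
  · exact (lact_tightComp τ σ ψ).symm.trans ((congrArg (fun x => lact x ψ) h₂).trans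
      (tightOne_lact ψ))
  · exact (lact_tightComp σ τ ψ).symm.trans ((congrArg (fun x => lact x ψ) h₁).trans
      (tightOne_lact ψ))

theorem exhibits_lact_iff {W X Y Z : V} (p : Loose W X) {ps : Weight Y Z} {f f' : Z ⟶ X}
    {c : Y ⟶ X} (u : Cell f ps c (looseId X)) {σ : TightTwoCell f' f} (hσ : IsTightInvertible σ) :
    Exhibits p (ps := ps) (lact σ u) ↔ Exhibits p u := by
  refine forall_congr' fun rs => ?_
  rw [← Function.Bijective.of_comp_iff' (hσ.lact_bijective (ps.append rs) (𝟙 W) p)]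
  refine iff_of_eq (congrArg _ (funext fun ψ => ?_))
  exact (eq_of_heq (lact_lact_heq σ u ψ)).symm

theorem exhibits_iff_of_lact_right {W X Y Z : V} (p : Loose W X) {ps : Weight Y Z} {f : Z ⟶ X}
    {c c' : Y ⟶ X} {u : Cell f ps c (looseId X)} {u' : Cell f ps c' (looseId X)}
    {σ : TightTwoCell c c'} (hσ : IsTightInvertible σ) (h : HEq (lact u σ) u') :
    Exhibits p u' ↔ Exhibits p u := by
  refine forall_congr' fun rs => ?_
  refine Iff.trans ?_ (Function.Bijective.of_comp_iff _ (hσ.lact_bijective rs (𝟙 W) p))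
  refine iff_of_eq (congrArg _ (funext fun ψ => eq_of_heq ?_))
  exact (lact_congr (LooseChain.append_nil ps) h ψ).symm.trans (lact_lact_heq u σ ψ).symm

/-- The hypothesis concerns unary tops, but `σ` is nullary. Acting on the cartesian 2-cell of `X(c',
1)` makes it unary, and precomposing with `conjointUnit c'` recovers it. -/
theorem lact_ext {A B X : V} {ps : Weight B A} {f : A ⟶ X} {c c' : B ⟶ X}
    {u : Cell f ps c (looseId X)}
    (hu : ∀ r : Loose X B, Function.Injective
      fun ψ : Cell c (.single r) (𝟙 X) (looseId X) => lact u ψ)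
    {σ τ : TightTwoCell c c'} (h : lact u σ = lact u τ) : σ = τ := by
  have hc : (lact σ (cart (looseId X) c' (𝟙 X)) : Cell c (.single _) (𝟙 X) _) =
      lact τ (cart (looseId X) c' (𝟙 X)) := by
    refine hu _ (eq_of_heq ?_)
    refine (lact_lact_heq u σ _).trans (HEq.trans ?_ (lact_lact_heq u τ _).symm)
    rw [h]
    rfl
  have key : ∀ σ : TightTwoCell c c', comp1 (conjointUnit c')
      (lact σ (cart (looseId X) c' (𝟙 X)) : Cell c (.single _) (𝟙 X) _) (Category.id_comp c)
      (Category.comp_id c') = σ := fun σ => by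
    refine (comp1_lact_of_nil σ _ _ _ (Category.id_comp c') (Category.comp_id c')).trans ?_
    rw [conjointUnit_cart]
    exact eq_of_heq (lact_tightOne σ)
  exact (key σ).symm.trans ((congrArg (fun x => comp1 (conjointUnit c') x _ _) hc).trans (key τ))

theorem exists_lact_heq {A B X : V} {ps : Weight B A} {f : A ⟶ X} {c c' : B ⟶ X}
    {u : Cell f ps c (looseId X)}
    (hu : ∀ r : Loose X B, Function.Surjective
      fun ψ : Cell c (.single r) (𝟙 X) (looseId X) => lact u ψ)
    (u' : Cell f ps c' (looseId X)) : ∃ σ : TightTwoCell c c', HEq (lact u σ) u' := by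
  obtain ⟨ψ, hψ⟩ := hu _ (lact u' (cart (looseId X) c' (𝟙 X)))
  refine ⟨comp1 (conjointUnit c') ψ (Category.id_comp c) (Category.comp_id c'), ?_⟩
  refine (heq_of_eq (lact_lastComp u (conjointUnit c') ψ (Category.comp_id c')).symm).trans ?_
  refine (heq_of_eq (congrArg (fun x => lastComp ps (conjointUnit c') x _) hψ)).trans ?_
  refine (heq_of_eq (lact_lastComp u' (conjointUnit c') _ (Category.comp_id c'))).trans ?_
  rw [conjointUnit_cart]
  exact lact_tightOne u'

/-- Two universal cocones have isomorphic apexes. Only unary tops are assumed, since full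
faithfulness will provide no more than these. -/
theorem exists_tightInvertible {A B X : V} {ps : Weight B A} {f : A ⟶ X} {c c' : B ⟶ X}
    {u : Cell f ps c (looseId X)} {u' : Cell f ps c' (looseId X)}
    (hu : ∀ r : Loose X B, Function.Bijective
      fun ψ : Cell c (.single r) (𝟙 X) (looseId X) => lact u ψ)
    (hu' : ∀ r : Loose X B, Function.Bijective
      fun ψ : Cell c' (.single r) (𝟙 X) (looseId X) => lact u' ψ) :
    ∃ σ : TightTwoCell c c', IsTightInvertible σ ∧ HEq (lact u σ) u' := by
  obtain ⟨σ, hσ⟩ := exists_lact_heq (fun r => (hu r).2) u'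
  obtain ⟨τ, hτ⟩ := exists_lact_heq (fun r => (hu' r).2) u
  have key : ∀ {c c' : B ⟶ X} {u : Cell f ps c (looseId X)} {u' : Cell f ps c' (looseId X)}
      {σ : TightTwoCell c c'} {τ : TightTwoCell c' c} (_ : HEq (lact u σ) u')
      (_ : HEq (lact u' τ) u) (_ : ∀ r : Loose X B, Function.Injective
      fun ψ : Cell c (.single r) (𝟙 X) (looseId X) => lact u ψ), tightComp σ τ = tightOne c := by
    intro c c' u u' σ τ hσ hτ hu
    refine lact_ext hu (eq_of_heq ?_)
    refine HEq.trans ?_ (lact_tightOne u).symm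
    refine HEq.trans ?_ hτ
    refine HEq.trans ?_ (lact_congr (LooseChain.append_nil ps) hσ τ)
    exact lact_lact_heq u σ τ
  exact ⟨σ, ⟨τ, key hσ hτ fun r => (hu r).1, key hτ hσ fun r => (hu' r).1⟩, hσ⟩

theorem IsExact.of_looseIso {Φ : WeightClass V} {X A : V} {p p' : Loose X A} (h : IsExact Φ p)
    (e : LooseIso p p') : IsExact Φ p' :=
  ⟨h.1, fun ps hps f c γ hγ => (respects_iff _ _ _ _).2
    (((respects_iff _ _ _ _).1 (h.2 ps hps f c γ hγ)).of_looseIso e)⟩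

theorem isCocontinuous_iff_isExact_conjoint {Φ : WeightClass V} {A B : V} (g : A ⟶ B) :
    IsCocontinuous Φ g ↔ IsExact Φ (conjoint g) := by
  simp only [IsCocontinuous, IsExact, preserves_iff_respects]

theorem isExact_looseId {Φ : WeightClass V} {A : V} (h : IsCocomplete Φ A) :
    IsExact Φ (looseId A) :=
  ⟨h, fun _ _ _ _ _ hγ => hγ⟩

theorem IsExact.restr {Φ : WeightClass V} {A X W : V} {p : Loose W X} (hp : IsExact Φ p)
    {g : A ⟶ X} (hg : IsCocontinuous Φ g) : IsExact Φ (restr p g (𝟙 W)) :=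
  ⟨hg.1, fun ps hps f c γ hγ => (respects_restr_iff _ _ _ _ _).2
    (hp.2 ps hps _ _ _ (hg.2 ps hps f c γ hγ))⟩

end Exhibits

/-! ### Right lifts through a conjoint -/

section ConjointLifts

variable {V : Type u} [VirtualDoubleCategory.{u, v, w, z} V] [VirtualEquipment V]

/-- The canonical 2-cell `E(j, 1), m ⇒ m(j, 1)`. -/
noncomputable def conjointAction {A E X : V} (j : A ⟶ E) (m : Loose X E) :
    Glob (.cons (conjoint j) (.single m)) (restr m j (𝟙 X)) :=
  factorGlob m j (𝟙 X) (lact (cart (looseId E) j (𝟙 E)) (idCell m))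

theorem comp1_counitRestr {A E X : V} (j : A ⟶ E) (p : Loose X A) (l : Loose X E)
    (ϖ : Glob (.cons (conjoint j) (.single l)) p) {rs : Weight X A}
    (t : Glob rs (restr l j (𝟙 X))) :
    comp1 t (counitRestr j p l ϖ) (Category.id_comp _) (Category.id_comp _) =
      comp2 (conjointUnit j) (comp1 t (cart l j (𝟙 X)) (Category.id_comp j) (Category.id_comp _)) ϖ
        (Category.id_comp _) (Category.id_comp _) :=
  lastComp_comp2 .nil t (conjointUnit j) (cart l j (𝟙 X)) _ ϖ _ _ _ _

/-- Transposing `ϖ` and transposing back, by the zigzag identity. Thus, when its counit is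
invertible, a lift is the canonical action of `E(j, 1)` up to isomorphism. -/
theorem conjointAction_counitRestr {A E X : V} (j : A ⟶ E) (p : Loose X A) (l : Loose X E)
    (ϖ : Glob (.cons (conjoint j) (.single l)) p) :
    comp1 (conjointAction j l) (counitRestr j p l ϖ) (Category.id_comp _) (Category.id_comp _) =
      ϖ := by
  rw [comp1_counitRestr]
  have e : comp1 (conjointAction j l) (cart l j (𝟙 X)) (Category.id_comp j) (Category.id_comp _) =
    lact (cart (looseId E) j (𝟙 E)) (idCell l) := factorGlob_cart _ _ _ _ _ _
  refine (congrArg (fun x => comp2 (conjointUnit j) x ϖ _ _) e).trans ?_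
  refine (eq_of_heq (comp2_lact_heq (conjointUnit j) (cart (looseId E) j (𝟙 E)) (idCell l) ϖ
    (Category.id_comp _) (Category.id_comp _))).trans ?_
  refine (congrArg (fun x => comp2 x (idCell l) ϖ (Category.id_comp _) (Category.id_comp _))
    (ract_conjointUnit_cart j)).trans ?_
  exact id_comp2 _ _ _

theorem exhibits_conjoint_iff {A E X : V} (j : A ⟶ E) (m : Loose X E) :
    Exhibits m (cart (looseId E) j (𝟙 E)) ↔
      IsRightLift (.single (conjoint j)) (restr m j (𝟙 X)) m (conjointAction j m) := by
  refine Iff.trans (forall_congr' fun rs => ?_) isRightLift_iff.symm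
  refine (bijective_iff_of_square (Q := fun ψ => comp1 ψ (cart m j (𝟙 X)) (Category.id_comp _)
    (Category.id_comp _)) (P := _root_.id) Function.bijective_id
    (comp1_cart_bijective m j (𝟙 X) (𝟙 A) (𝟙 X) _ (Category.id_comp j) (Category.id_comp _))
    fun ψ => ?_).symm
  refine (lastComp_comp1 (.single (conjoint j)) ψ (conjointAction j m) (Category.id_comp _)
    (cart m j (𝟙 X)) (Category.id_comp j) (Category.id_comp _) _ (Category.id_comp _)).symm.trans ?_
  have e : comp1 (conjointAction j m) (cart m j (𝟙 X)) (Category.id_comp j) (Category.id_comp _) =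
    lact (cart (looseId E) j (𝟙 E)) (idCell m) := factorGlob_cart _ _ _ _ _ _
  refine (congrArg (fun x => lastComp (.single (conjoint j)) ψ x _) e).trans ?_
  refine (lact_lastComp (cart (looseId E) j (𝟙 E)) ψ (idCell m) (Category.comp_id _)).trans ?_
  exact congrArg (fun x => lact (cart (looseId E) j (𝟙 E)) x) (comp1_id ψ _ _)

/-- Under the cartesian 2-cell of `E(j, 1)` the right unitor becomes a right action on a 2-cell into
`E(1, 1)`, where left and right actions agree. -/
theorem isDense_iff {A E : V} (j : A ⟶ E) :
    IsDense j ↔ Exhibits (looseId E) (cart (looseId E) j (𝟙 E)) := by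
  refine isRightLift_iff.trans (forall_congr' fun rs => ?_)
  refine bijective_iff_of_square (Q := fun ψ => comp1 ψ (cart (looseId E) j (𝟙 E))
    (Category.id_comp _) (Category.id_comp _)) (P := _root_.id) Function.bijective_id
    (comp1_cart_bijective (looseId E) j (𝟙 E) (𝟙 A) (𝟙 E) _ (Category.id_comp j)
      (Category.id_comp _)) fun ψ => ?_
  refine (lastComp_comp1 (.single (conjoint j)) ψ (rightUnitor (conjoint j)) (Category.id_comp _)
    (cart (looseId E) j (𝟙 E)) (Category.id_comp j) (Category.id_comp _) _
    (Category.id_comp _)).symm.trans ?_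
  refine (congrArg (fun x => lastComp (.single (conjoint j)) ψ x (Category.id_comp _))
    (rightUnitor_comp1 _ _ _ (Category.comp_id j) (Category.id_comp _))).trans ?_
  refine (lastComp_comp2 (.single (conjoint j)) ψ (cart (looseId E) j (𝟙 E)) (looseIdMap (𝟙 E))
    (Category.id_comp _) _ _ _ (Category.id_comp _) _).trans ?_
  rw [looseIdMap_id, comp1_id]
  exact ract_eq_lact _ _

theorem comp1_counitRestr_bijective_iff {A E X : V} (j : A ⟶ E) (p : Loose X A) (l : Loose X E)
    (ϖ : Glob (.cons (conjoint j) (.single l)) p) (rs : Weight X A) :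
    (Function.Bijective fun t : Glob rs (restr l j (𝟙 X)) =>
      comp1 t (counitRestr j p l ϖ) (Category.id_comp _) (Category.id_comp _)) ↔
    Function.Bijective fun χ : Cell j rs (𝟙 X) l =>
      (comp2 (conjointUnit j) χ ϖ (Category.id_comp _) (Category.id_comp _) : Glob rs p) :=
  bijective_iff_of_square (Q := _root_.id)
    (comp1_cart_bijective l j (𝟙 X) (𝟙 A) (𝟙 X) rs (Category.id_comp j) (Category.id_comp _))
    Function.bijective_id fun t => comp1_counitRestr j p l ϖ t

/-- The nullary 2-cell into the companion `B(1, f)` with left side `f` and right side `1`. -/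
noncomputable def companionUnit {A B : V} (f : A ⟶ B) : Cell f .nil (𝟙 A) (hom (𝟙 B) f) :=
  factor (looseId B) (𝟙 B) f f (𝟙 A) (Category.comp_id f).symm (Category.id_comp f).symm
    (tightOne f)

theorem companionUnit_cart {A B : V} (f : A ⟶ B) (h : f ≫ 𝟙 B = f) (h' : 𝟙 A ≫ f = f) :
    comp1 (companionUnit f) (cart (looseId B) (𝟙 B) f) h h' = tightOne f :=
  factor_cart _ _ _ _ _ _ _ _ _ _

theorem lact_cart_companionUnit {A B : V} (f : A ⟶ B) :
    lact (cart (looseId B) (𝟙 B) f) (companionUnit f) = idCell (hom (𝟙 B) f) := by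
  refine cart_ext (Category.id_comp _) (Category.id_comp f) ?_
  refine (lact_comp1_of_id _ _ _ (Category.id_comp _) (Category.comp_id f) _).trans ?_
  refine Eq.trans ?_ (id_comp1 _ _ _).symm
  rw [companionUnit_cart]
  exact eq_of_heq (lact_tightOne _)

/-- The canonical 2-cell `B(f, 1), B(1, f) ⇒ B(f, f)`. -/
noncomputable def conjointCompanion {A B : V} (f : A ⟶ B) :
    Glob (.cons (conjoint f) (.single (hom (𝟙 B) f))) (hom f f) :=
  factorGlob (looseId B) f f (lact (cart (looseId B) f (𝟙 B)) (cart (looseId B) (𝟙 B) f))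

theorem conjointCompanion_cart {A B : V} (f : A ⟶ B) (h h' : 𝟙 A ≫ f = f) :
    comp1 (conjointCompanion f) (cart (looseId B) f f) h h' =
      lact (cart (looseId B) f (𝟙 B)) (cart (looseId B) (𝟙 B) f) :=
  factorGlob_cart _ _ _ _ _ _

theorem homMap_cart {A B : V} (f : A ⟶ B) (h h' : 𝟙 A ≫ f = f) :
    comp1 (homMap f) (cart (looseId B) f f) h h' = looseIdMap f :=
  factorGlob_cart _ _ _ _ _ _

theorem unit_homMap_cart {A B : V} (f : A ⟶ B) (h h' : 𝟙 A ≫ f = f) :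
    comp1 (comp1 (unit A) (homMap f) (Category.id_comp _) (Category.id_comp _))
      (cart (looseId B) f f) h h' = tightOne f := by
  refine (comp1_assoc (unit A) (homMap f) _ h h' h h' _ _ _ _).symm.trans ?_
  rw [homMap_cart, unit_looseIdMap]

theorem units_conjointCompanion {A B : V} (f : A ⟶ B) :
    comp2 (conjointUnit f) (companionUnit f) (conjointCompanion f) (Category.id_comp _)
      (Category.id_comp _) = comp1 (unit A) (homMap f) (Category.id_comp _) (Category.id_comp _) := by
  refine cart_ext (Category.id_comp f) (Category.id_comp f) ?_
  refine Eq.trans ?_ (unit_homMap_cart f _ _).symm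
  refine (comp2_comp1 _ _ _ _ (Category.id_comp f) (Category.id_comp f) (Category.id_comp f)
    (Category.id_comp f) _ _ _ _).symm.trans ?_
  rw [conjointCompanion_cart]
  refine (comp2_comp2 (conjointUnit f) (companionUnit f) _ _ _ _ _ _ _ (Category.id_comp f)
    (Category.comp_id f) (Category.id_comp f) (Category.comp_id f) (Category.comp_id f)).trans ?_
  rw [conjointUnit_cart, companionUnit_cart]
  exact tightOne_lact (tightOne f)

end ConjointLifts

/-! ### Full faithfulness and invertibility of counits -/

section FullyFaithful

variable {V : Type u} [VirtualDoubleCategory.{u, v, w, z} V] [VirtualEquipment V]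

/-- Here `κ` is composition `E(j, 1), E(1, j) ⇒ E(j, j)` followed by the inverse of `homMap j`. -/
theorem IsFullyFaithful.exists_retraction {A E : V} {j : A ⟶ E} (hj : IsFullyFaithful j) :
    ∃ κ : Glob (.cons (conjoint j) (.single (hom (𝟙 E) j))) (looseId A),
      comp2 (conjointUnit j) (companionUnit j) κ (Category.id_comp _) (Category.id_comp _) = unit A ∧
      comp1 κ (looseIdMap j) (Category.id_comp j) (Category.id_comp j) =
        lact (cart (looseId E) j (𝟙 E)) (cart (looseId E) (𝟙 E) j) := by
  obtain ⟨δ, h₁, h₂⟩ := hj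
  refine ⟨comp1 (conjointCompanion j) δ (Category.id_comp _) (Category.id_comp _), ?_, ?_⟩
  · refine (comp2_comp1 _ _ _ _ _ _ _ _ (Category.id_comp _) (Category.id_comp _)
      (Category.id_comp _) (Category.id_comp _)).trans ?_
    rw [units_conjointCompanion]
    refine (comp1_assoc _ _ _ (Category.id_comp _) (Category.id_comp _) (Category.id_comp _)
      (Category.id_comp _) _ _ _ _).symm.trans ?_
    refine (congrArg (fun x => comp1 (unit A) x _ _) h₁).trans ?_
    exact comp1_id _ _ _
  · rw [← homMap_cart j (Category.id_comp j) (Category.id_comp j),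
      comp1_assoc _ (homMap j) _ _ _ _ _ (Category.id_comp _) (Category.id_comp _)
        (Category.id_comp j) (Category.id_comp j),
      ← comp1_assoc _ δ (homMap j) (Category.id_comp _) (Category.id_comp _) (Category.id_comp _)
        (Category.id_comp _)]
    refine Eq.trans ?_ (conjointCompanion_cart j (Category.id_comp j) (Category.id_comp j))
    refine congrArg (fun x => comp1 x (cart (looseId E) j j) (Category.id_comp j)
      (Category.id_comp j)) ?_
    refine Eq.trans ?_ (comp1_id (conjointCompanion j) (Category.id_comp _) (Category.id_comp _))
    exact congrArg (fun x => comp1 (conjointCompanion j) x (Category.id_comp _)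
      (Category.id_comp _)) h₂

/-- Heuristically `l(j, 1)` is the lift of `q` through `E(j, j) ≅ A(1, 1)`, which is `q`. Instead of
a composite of `E(j, 1)` and `E(1, j)`, the argument uses the chain of both and the 2-cell `κ` out
of it. -/
theorem IsFullyFaithful.lift_bijective {A E X : V} {j : A ⟶ E} (hj : IsFullyFaithful j)
    {q : Loose X A} {l : Loose X E} {ϖ : Glob (.cons (conjoint j) (.single l)) q}
    (hϖ : IsRightLift (.single (conjoint j)) q l ϖ) (r : Loose X A) :
    Function.Bijective fun χ : Cell j (.single r) (𝟙 X) l =>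
      (comp2 (conjointUnit j) χ ϖ (Category.id_comp _) (Category.id_comp _) :
        Glob (.single r) q) := by
  obtain ⟨κ, h₁, h₂⟩ := hj.exists_retraction
  have hϖ := isRightLift_iff.1 hϖ
  have h₃ : ract (idCell (conjoint j)) (cart (looseId E) (𝟙 E) j) = lact κ (conjointUnit j) := by
    refine cart_ext (Category.id_comp j) (Category.comp_id j) ?_
    refine (ract_comp1_of_id _ _ _ _ (Category.id_comp _) _).trans ?_
    refine Eq.trans ?_ (lact_comp1 κ (conjointUnit j) _ _ (Category.id_comp j) _).symm
    rw [id_comp1, ract_eq_lact, conjointUnit_cart, h₂]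
    exact (eq_of_heq (lact_tightOne _)).symm
  constructor
  · intro χ χ' h
    -- Adding `E(1, j)` to the top makes `χ` globular, so that the lift detects it; by `h₃` its
    -- image under the lift depends only on the image of `χ` under the map in question.
    have e : ∀ χ : Cell j (.single r) (𝟙 X) l,
        lastComp (.single (conjoint j)) (lact (cart (looseId E) (𝟙 E) j) χ) ϖ
          (Category.id_comp _) =
        lact κ (comp2 (conjointUnit j) χ ϖ (Category.id_comp _) (Category.id_comp _)) := by
      intro χ
      refine (eq_of_heq (comp2_lact_heq (idCell (conjoint j)) (cart (looseId E) (𝟙 E) j) χ ϖ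
        (Category.id_comp _) (Category.id_comp _))).trans ?_
      refine (congrArg (fun x => comp2 x χ ϖ (Category.id_comp _) (Category.id_comp _)) h₃).trans ?_
      exact (eq_of_heq (lact_comp2_heq κ (conjointUnit j) χ ϖ _ _ _)).symm
    have h' := (hϖ _).1 ((e χ).trans ((congrArg (fun x => lact κ x) h).trans (e χ').symm))
    have e' : ∀ χ : Cell j (.single r) (𝟙 X) l,
        comp2 (companionUnit j) (idCell r) (lact (cart (looseId E) (𝟙 E) j) χ)
          (Category.comp_id j) (Category.id_comp _) = χ := by
      intro χ
      refine (comp2_comp2 _ _ _ _ _ _ _ _ _ (Category.comp_id j) (Category.id_comp j)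
        (Category.id_comp _) (Category.comp_id j) (Category.comp_id _)).trans ?_
      rw [companionUnit_cart, id_comp1]
      exact tightOne_lact χ
    exact (e' χ).symm.trans ((congrArg (fun x => comp2 (companionUnit j) (idCell r) x
      (Category.comp_id j) (Category.id_comp _)) h').trans (e' χ'))
  · intro θ
    change Glob (.single r) q at θ
    -- Spread `θ` over `E(j, 1), E(1, j), r` by means of `κ`, lift, and fill `E(1, j)` with its
    -- unit.
    obtain ⟨τ, hτ⟩ : ∃ τ : Glob (.cons (hom (𝟙 E) j) (.single r)) l,
        comp2 (idCell (conjoint j)) τ ϖ (Category.id_comp _) (Category.id_comp _) =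
          comp2 κ θ (leftUnitor q) (Category.id_comp _) (Category.id_comp _) := (hϖ _).2 _
    refine ⟨comp2 (companionUnit j) (idCell r) τ (Category.comp_id j) (Category.id_comp _), ?_⟩
    have := comp2_right_eq_left (conjointUnit j) (companionUnit j) (idCell r) hτ
      (Category.id_comp _) (Category.comp_id j) (Category.id_comp _) (Category.id_comp _)
      (Category.id_comp _) (Category.id_comp _) (Category.id_comp _) (Category.id_comp _)
      (Category.id_comp _) (Category.id_comp _)
    rw [comp1_id, h₁, id_comp1] at this
    exact (eq_of_heq this).trans (unit_lact θ)

theorem IsFullyFaithful.isInvertible_counitRestr {A E X : V} {j : A ⟶ E} (hj : IsFullyFaithful j)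
    {q : Loose X A} {l : Loose X E} {ϖ : Glob (.cons (conjoint j) (.single l)) q}
    (hϖ : IsRightLift (.single (conjoint j)) q l ϖ) : IsInvertible (counitRestr j q l ϖ) :=
  isInvertible_of_bijective fun r =>
    (comp1_counitRestr_bijective_iff j q l ϖ (.single r)).2 (hj.lift_bijective hϖ r)

/-- The lift of `A(1, 1)` yields a candidate inverse of `homMap j`. One composite is checked on the
unit of `A`, the other on the corresponding nullary 2-cell `υ` of `E(j, j)`, which is legitimate
because the lifts make `υ` epimorphic for 2-cells into any `q`. -/
theorem isFullyFaithful_of_lifts {A E : V} {j : A ⟶ E}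
    (h : ∀ q : Loose A A, ∃ (l : Loose A E) (ϖ : Glob (.cons (conjoint j) (.single l)) q),
      IsRightLift (.single (conjoint j)) q l ϖ ∧ IsInvertible (counitRestr j q l ϖ)) :
    IsFullyFaithful j := by
  let η := conjointUnit j
  let η' := companionUnit j
  let υ : Glob .nil (hom j j) :=
    comp1 (unit A) (homMap j) (Category.id_comp _) (Category.id_comp _)
  -- This views `E(j, j)` as the restriction of `E(j, 1)` along `j`, so that paired with `η'` it
  -- splits the composition 2-cell.
  let ρ : Cell (𝟙 A) (.single (hom j j)) j (conjoint j) :=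
    factor (looseId E) j (𝟙 E) (𝟙 A) j (Category.id_comp j).symm (Category.comp_id j).symm
      (cart (looseId E) j j)
  have hρ : comp1 ρ (cart (looseId E) j (𝟙 E)) (Category.id_comp j) (Category.comp_id j) =
      cart (looseId E) j j := factor_cart _ _ _ _ _ _ _ _ _ _
  have hρη : comp2 ρ η' (conjointCompanion j) (Category.id_comp _) (Category.id_comp _) =
      idCell (hom j j) := by
    refine cart_ext (Category.id_comp j) (Category.id_comp j) ?_
    refine Eq.trans ?_ (id_comp1 _ _ _).symm
    refine (comp2_comp1 _ _ _ _ (Category.id_comp j) (Category.id_comp j) (Category.id_comp j)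
      (Category.id_comp j) _ _ _ _).symm.trans ?_
    rw [conjointCompanion_cart]
    refine (comp2_comp2 ρ η' _ _ _ _ _ _ _ (Category.id_comp j)
      (Category.comp_id j) (Category.id_comp j) (Category.comp_id j) (Category.comp_id j)).trans ?_
    rw [hρ, companionUnit_cart]
    exact eq_of_heq (lact_tightOne _)
  have hυρ : comp1 υ ρ (Category.id_comp _) (Category.id_comp j) = η := by
    refine cart_ext (Category.id_comp j) (Category.comp_id j) ?_
    refine (comp1_assoc υ ρ _ (Category.id_comp j) (Category.comp_id j) (Category.id_comp j)
      (Category.id_comp j) _ _ _ _).symm.trans ?_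
    rw [hρ, conjointUnit_cart]
    exact unit_homMap_cart j _ _
  have hbij : ∀ q : Loose A A, ∃ (l : Loose A E) (ϖ : Glob (.cons (conjoint j) (.single l)) q),
      IsRightLift (.single (conjoint j)) q l ϖ ∧
      Function.Bijective fun χ : Cell j .nil (𝟙 A) l =>
        (comp2 η χ ϖ (Category.id_comp _) (Category.id_comp _) : Glob .nil q) := by
    intro q
    obtain ⟨l, ϖ, hϖ, hε⟩ := h q
    exact ⟨l, ϖ, hϖ, (comp1_counitRestr_bijective_iff j q l ϖ .nil).1
      (hε.comp1_bijective (𝟙 A) (𝟙 A) .nil)⟩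
  -- Lift `σ`, composed with `conjointCompanion j`, to `α : E(1, j) ⇒ l`. Then `α` is determined by
  -- its restriction along `η'`, and that by `υ` followed by `σ` through the invertible counit;
  -- finally `ρ` and `η'` recover `σ`.
  have hinj : ∀ (q : Loose A A) (σ τ : Glob (.single (hom j j)) q),
      comp1 υ σ (Category.id_comp _) (Category.id_comp _) =
        comp1 υ τ (Category.id_comp _) (Category.id_comp _) → σ = τ := by
    intro q σ τ hστ
    obtain ⟨l, ϖ, hϖ, hb⟩ := hbij q
    have hϖ := isRightLift_iff.1 hϖ
    have hlift : ∀ σ : Glob (.single (hom j j)) q, ∃ α : Glob (.single (hom (𝟙 E) j)) l,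
        comp2 (idCell (conjoint j)) α ϖ (Category.id_comp _) (Category.id_comp _) =
          comp1 (conjointCompanion j) σ (Category.id_comp _) (Category.id_comp _) :=
      fun σ => (hϖ _).2 _
    obtain ⟨α, hα⟩ := hlift σ
    obtain ⟨β, hβ⟩ := hlift τ
    have e : ∀ (σ : Glob (.single (hom j j)) q) (α : Glob (.single (hom (𝟙 E) j)) l),
        comp2 (idCell (conjoint j)) α ϖ (Category.id_comp _) (Category.id_comp _) =
          comp1 (conjointCompanion j) σ (Category.id_comp _) (Category.id_comp _) →
        comp2 η (comp1 η' α (Category.comp_id j) (Category.id_comp _)) ϖ (Category.id_comp _)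
          (Category.id_comp _) = comp1 υ σ (Category.id_comp _) (Category.id_comp _) := by
      intro σ α hα
      have e₁ := comp2_comp2 η η' (idCell (conjoint j)) α ϖ (Category.id_comp _)
        (Category.id_comp _) (Category.id_comp _) (Category.id_comp _) (Category.id_comp _)
        (Category.comp_id j) (Category.id_comp _) (Category.id_comp _) (Category.id_comp _)
      rw [comp1_id] at e₁
      refine e₁.symm.trans ((congrArg (fun x => comp2 η η' x (Category.id_comp _)
        (Category.id_comp _)) hα).trans ?_)
      refine (comp2_comp1 _ _ _ _ _ _ _ _ (Category.id_comp _) (Category.id_comp _)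
        (Category.id_comp _) (Category.id_comp _)).trans ?_
      exact congrArg (fun x => comp1 x σ (Category.id_comp _) (Category.id_comp _))
        (units_conjointCompanion j)
    have hχ : comp1 η' α (Category.comp_id j) (Category.id_comp _) =
        comp1 η' β (Category.comp_id j) (Category.id_comp _) :=
      hb.1 ((e σ α hα).trans (hστ.trans (e τ β hβ).symm))
    have e' : ∀ α : Glob (.single (hom (𝟙 E) j)) l, lact (cart (looseId E) (𝟙 E) j)
        (comp1 η' α (Category.comp_id j) (Category.id_comp _)) = α := by
      intro α
      refine (lact_comp1_of_id _ _ α (Category.id_comp _) _ _).symm.trans ?_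
      refine Eq.trans ?_ (id_comp1 α (Category.id_comp _) (Category.id_comp _))
      exact congrArg (fun x => comp1 x α (Category.id_comp _) (Category.id_comp _))
        (lact_cart_companionUnit j)
    have hαβ : α = β := (e' α).symm.trans
      ((congrArg (fun x => lact (cart (looseId E) (𝟙 E) j) x) hχ).trans (e' β))
    subst hαβ
    have e'' : ∀ σ : Glob (.single (hom j j)) q, comp2 ρ η'
        (comp1 (conjointCompanion j) σ (Category.id_comp _) (Category.id_comp _))
        (Category.id_comp _) (Category.id_comp _) = σ := by
      intro σ
      refine (comp2_comp1 _ _ _ _ _ _ _ _ (Category.id_comp _) (Category.id_comp _)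
        (Category.id_comp _) (Category.id_comp _)).trans ?_
      refine (congrArg (fun x => comp1 x σ (Category.id_comp _) (Category.id_comp _)) hρη).trans ?_
      exact id_comp1 _ _ _
    rw [← e'' σ, ← e'' τ, ← hα, ← hβ]
  obtain ⟨l, ϖ, hϖ, hb⟩ := hbij (looseId A)
  obtain ⟨χ, hχ⟩ := hb.2 (unit A)
  -- The nullary `χ` transposes the unit of `A` through the lift; replacing `η` by `ρ` extends that
  -- factorisation from the empty top to `E(j, j)`.
  let δ : Glob (.single (hom j j)) (looseId A) :=
    comp2 ρ χ ϖ (Category.id_comp _) (Category.id_comp _)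
  have hυδ : comp1 υ δ (Category.id_comp _) (Category.id_comp _) = unit A := by
    refine (compRow_comp2 (.single υ) (.nil (𝟙 A)) ρ χ ϖ _ _ _ _ (Category.id_comp _)
      (Category.id_comp j) (Category.id_comp _) (Category.id_comp _) (Category.id_comp _)).trans ?_
    refine Eq.trans ?_ hχ
    refine (congrArg (fun x => comp2 x _ ϖ _ _) hυρ).trans ?_
    exact congrArg (fun x => comp2 η x ϖ (Category.id_comp _) (Category.id_comp _))
      (compRow_ids χ _ _)
  refine ⟨δ, ?_, ?_⟩
  · refine unit_ext .nil .nil ?_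
    refine (comp1_assoc (unit A) (homMap j) δ _ _ _ _ (Category.id_comp _) (Category.id_comp _)
      (Category.id_comp _) (Category.id_comp _)).trans ?_
    exact hυδ.trans (comp1_id _ _ _).symm
  · refine hinj _ _ _ ?_
    refine (comp1_assoc υ δ (homMap j) (Category.id_comp _) (Category.id_comp _) (Category.id_comp _)
      (Category.id_comp _) (Category.id_comp _) (Category.id_comp _)
      (Category.id_comp _) (Category.id_comp _)).trans ?_
    rw [hυδ]
    exact (comp1_id υ _ _).symm

end FullyFaithful

/-! ### Left extensions and the two implications -/

section Cocompletions

variable {V : Type u} [VirtualDoubleCategory.{u, v, w, z} V] [VirtualEquipment V]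

theorem coconeAction_cart {W X Y Z : V} {q : Loose Y Z} {f : Z ⟶ X} {c : Y ⟶ X}
    (γ : Glob (.single q) (hom f c)) (p : Loose W X) (h : 𝟙 Z ≫ f = f) (h' : 𝟙 W ≫ 𝟙 W = 𝟙 W) :
    comp1 (coconeAction γ p) (cart p f (𝟙 W)) h h' =
      lact (comp1 γ (cart (looseId X) f c) (Category.id_comp f) (Category.id_comp c))
        (cart p c (𝟙 W)) := by
  refine (comp2_comp1 γ (idCell _) (action p f c) _ h h' (Category.id_comp f) (Category.id_comp _)
    _ _ _ _).symm.trans ?_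
  rw [action_cart]
  refine (comp2_comp2 γ (idCell _) _ _ _ _ _ _ _ (Category.id_comp f) (Category.id_comp c)
    (Category.id_comp _) (Category.comp_id f) (Category.comp_id _)).trans ?_
  rw [id_comp1]
  rfl

theorem leftExtensionUnit_eq {X Y Z : V} (j : Z ⟶ Y) (f : Z ⟶ X) (c : Y ⟶ X)
    (γ : Glob (.single (conjoint j)) (hom f c)) :
    leftExtensionUnit j f c γ = comp1 (conjointUnit j)
      (comp1 γ (cart (looseId X) f c) (Category.id_comp f) (Category.id_comp c))
      (Category.id_comp f) rfl :=
  (comp1_assoc _ _ _ _ _ _ _ (Category.id_comp _) (Category.comp_id j) _ _).symm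

/-- Any cocone with weight the conjoint of `j` is recovered from its unit and the image under `c` of
the canonical cocone on `j`. When the unit is invertible, the question of respect is thus moved to
the cocone on `j`. -/
theorem leftExtensionUnit_lact {X Y Z : V} (j : Z ⟶ Y) (f : Z ⟶ X) (c : Y ⟶ X)
    (γ : Glob (.single (conjoint j)) (hom f c)) :
    (lact (leftExtensionUnit j f c γ) (comp1 (cart (looseId Y) j (𝟙 Y)) (looseIdMap c) rfl
      (Category.id_comp c)) : Cell f (.single (conjoint j)) c (looseId X)) =
      comp1 γ (cart (looseId X) f c) (Category.id_comp f) (Category.id_comp c) := by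
  rw [leftExtensionUnit_eq, ← ract_eq_lact]
  refine (ract_comp1 (conjointUnit j) (cart (looseId Y) j (𝟙 Y)) _ (Category.id_comp f) rfl
    (Category.id_comp c)).symm.trans ?_
  refine (congrArg (fun x => comp1 x _ (Category.id_comp f) (Category.id_comp c))
    (ract_conjointUnit_cart j)).trans ?_
  exact id_comp1 _ _ _

theorem IsFullyFaithful.isTightInvertible_leftExtensionUnit {A E X : V} {j : A ⟶ E}
    (hj : IsFullyFaithful j) {f : A ⟶ X} {c : E ⟶ X} {γ : Glob (.single (conjoint j)) (hom f c)}
    (h : IsLeftExtension j f c γ) : IsTightInvertible (leftExtensionUnit j f c γ) := by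
  have hυ : ∀ r : Loose X A, Function.Bijective
      fun ψ : Cell (j ≫ c) (.single r) (𝟙 X) (looseId X) =>
        (lact (leftExtensionUnit j f c γ) ψ : Cell f (.single r) (𝟙 X) (looseId X)) := by
    intro r
    refine (bijective_iff_of_square
      (comp1_cart_bijective (looseId X) c (𝟙 X) j (𝟙 X) (.single r) rfl (Category.id_comp _))
      (comp1_cart_bijective (looseId X) f (𝟙 X) (𝟙 A) (𝟙 X) (.single r) (Category.id_comp f)
        (Category.id_comp _)) fun χ => ?_).1 (hj.lift_bijective h r)
    refine (comp2_comp1 (conjointUnit j) χ _ _ (Category.id_comp f) (Category.id_comp _)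
      (Category.id_comp f) (Category.id_comp _) _ _ _ _).symm.trans ?_
    refine (congrArg (fun x => comp2 (conjointUnit j) χ x _ _)
      (coconeAction_cart γ (looseId X) _ _)).trans ?_
    refine (comp2_comp2 (conjointUnit j) χ _ _ _ _ _ _ _ (Category.id_comp f) rfl
      (Category.id_comp _) (Category.comp_id f) (Category.comp_id _)).trans ?_
    rw [leftExtensionUnit_eq]
    rfl
  have h1 : ∀ r : Loose X A, Function.Bijective
      fun ψ : Cell f (.single r) (𝟙 X) (looseId X) =>
        (lact (tightOne f) ψ : Cell f (.single r) (𝟙 X) (looseId X)) := by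
    intro r
    have e : (fun ψ : Cell f (.single r) (𝟙 X) (looseId X) =>
        (lact (tightOne f) ψ : Cell f (.single r) (𝟙 X) (looseId X))) = _root_.id :=
      funext tightOne_lact
    exact e ▸ Function.bijective_id
  -- The identity of `f` and the unit are both universal among nullary cocones on `f`, tested on
  -- unary tops; the comparison between them is the unit itself.
  obtain ⟨σ, hσ, e⟩ := exists_tightInvertible (ps := .nil) h1 hυ
  have : σ = leftExtensionUnit j f c γ := (tightOne_lact σ).symm.trans (eq_of_heq e)
  rwa [← this]

theorem isColimit_id_iff {A E : V} (j : A ⟶ E) :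
    IsColimit (ps := .single (conjoint j)) j (𝟙 E) (idCell (conjoint j)) ↔ IsDense j := by
  rw [isColimit_iff, isDense_iff, id_comp1]

theorem Exhibits.exists_tightInvertible {X Y Z : V} {ps : Weight Y Z} {f : Z ⟶ X} {c c' : Y ⟶ X}
    {u : Cell f ps c (looseId X)} {u' : Cell f ps c' (looseId X)} (h : Exhibits (looseId X) u)
    (h' : Exhibits (looseId X) u') :
    ∃ σ : TightTwoCell c c', IsTightInvertible σ ∧ HEq (lact u σ) u' :=
  VDC.exists_tightInvertible (fun r => h (.single r)) fun r => h' (.single r)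

theorem isCocompletion_of_conditions {Φ : WeightClass V} {A E : V} {j : A ⟶ E}
    (h₁ : IsCocomplete Φ E) (h₂ : LooseChain.single (conjoint j) ∈ saturation Φ E A)
    (h₃ : IsLifting (.single (conjoint j)))
    (h₄ : ∀ (X : V) (p : Loose X A) (l : Loose X E) (ϖ : Glob (.cons (conjoint j) (.single l)) p),
      IsRightLift (.single (conjoint j)) p l ϖ → IsExact Φ l)
    (h₅ : IsDense j) (h₆ : IsFullyFaithful j) : IsCocompletion Φ j := by
  obtain ⟨⟨hcoc, hcocts, hexact⟩, -⟩ := (saturation_isGreatest Φ).1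
  refine ⟨h₁, fun {X} f hX => ?_, fun {X} p => ?_⟩
  · obtain ⟨c, γ, hγ⟩ := hcoc X hX _ h₂ f
    refine ⟨c, γ, hγ, h₆.isTightInvertible_leftExtensionUnit hγ,
      (isCocontinuous_iff_isExact_conjoint c).2 (h₄ X _ _ _ hγ), fun f' hf' ⟨σ, hσ⟩ => ?_⟩
    -- By density `1` is the colimit of `j` weighted by `E(j, 1)`; as `f'` preserves it, `f'` is a
    -- left extension of `j ≫ f'`, hence of `f`.
    have hp := (hcocts f' hf').2 _ h₂ j (𝟙 E) (idCell _) ((isColimit_id_iff j).2 h₅)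
    rw [preserves_iff_respects, respects_iff, id_comp1,
      exhibits_restr_iff _ _ _ rfl (Category.id_comp f')] at hp
    obtain ⟨τ, hτ, -⟩ := Exhibits.exists_tightInvertible (ps := .single (conjoint j))
      ((exhibits_lact_iff _ _ hσ).2 hp) ((isColimit_iff _ _ _).1 hγ)
    exact ⟨τ, hτ⟩
  · obtain ⟨l, ϖ, hϖ⟩ := h₃ X p
    refine ⟨l, ϖ, hϖ, h₆.isInvertible_counitRestr hϖ, h₄ X p l ϖ hϖ, fun p' hp' e => ?_⟩
    have hr := (hexact p' hp').2 _ h₂ j (𝟙 E) (idCell _) ((isColimit_id_iff j).2 h₅)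
    rw [respects_iff, id_comp1, exhibits_conjoint_iff] at hr
    obtain ⟨α, hα⟩ := e.symm
    exact (hr.comp1 hα).exists_iso hϖ

/-- Both `m` and the lift `l` of `m(j, 1)` are exact extensions of `m(j, 1)`, so `m ≅ l` by
uniqueness. Invertibility of the counit makes `l` the lift of its own restriction by the canonical
2-cell. -/
theorem IsCocompletion.exhibits {Φ : WeightClass V} {A E : V} {j : A ⟶ E}
    (h : IsCocompletion Φ j) {X : V} {m : Loose X E} (hm : IsExact Φ m) :
    Exhibits m (cart (looseId E) j (𝟙 E)) := by
  obtain ⟨l, ϖ, hϖ, hε, -, huniq⟩ := h.loose (restr m j (𝟙 X))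
  have hlm := huniq m hm (LooseIso.refl _)
  exact ((exhibits_conjoint_iff j l).2 (by
    obtain ⟨ε', hε₁, hε₂⟩ := hε
    have := hϖ.comp1 (α := ε') ⟨_, hε₂, hε₁⟩
    have e : comp1 ϖ ε' (Category.comp_id _) (Category.comp_id _) = conjointAction j l := by
      rw [← conjointAction_counitRestr j _ l ϖ]
      refine (comp1_assoc _ _ _ (Category.id_comp _) (Category.id_comp _) (Category.id_comp _)
        (Category.id_comp _) _ _ _ _).symm.trans ?_
      exact (congrArg (fun x => comp1 (conjointAction j l) x _ _) hε₁).trans (comp1_id _ _ _)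
    exact e ▸ this)).of_looseIso hlm.symm

theorem IsCocompletion.isExact_of_isRightLift {Φ : WeightClass V} {A E : V} {j : A ⟶ E}
    (h : IsCocompletion Φ j) {X : V} {p : Loose X A} {l : Loose X E}
    {ϖ : Glob (.cons (conjoint j) (.single l)) p}
    (hϖ : IsRightLift (.single (conjoint j)) p l ϖ) : IsExact Φ l := by
  obtain ⟨l', ϖ', hϖ', -, hl', -⟩ := h.loose p
  exact hl'.of_looseIso (hϖ'.exists_iso hϖ)

/-- Compare with the extension `c₀` given by the cocompletion and discard its invertible unit. What
remains is that `p(c₀, 1)` respects the canonical cocone on `j`, which holds because it is exact. -/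
theorem IsCocompletion.exhibits_of_isLeftExtension {Φ : WeightClass V} {A E : V} {j : A ⟶ E}
    (h : IsCocompletion Φ j) {W X : V} {p : Loose W X} (hp : IsExact Φ p) {f : A ⟶ X} {c : E ⟶ X}
    {γ : Glob (.single (conjoint j)) (hom f c)} (hγ : IsLeftExtension j f c γ) :
    Respects (ps := .single (conjoint j)) p f c γ := by
  obtain ⟨c₀, γ₀, hγ₀, hυ, hc₀, -⟩ := h.tight f hp.1
  obtain ⟨σ, hσ, e⟩ := Exhibits.exists_tightInvertible ((isColimit_iff f c₀ γ₀).1 hγ₀)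
    ((isColimit_iff f c γ).1 hγ)
  rw [respects_iff, exhibits_iff_of_lact_right p hσ e, ← leftExtensionUnit_lact]
  refine (exhibits_lact_iff p (ps := .single (conjoint j)) _ hυ).2 ?_
  exact (exhibits_restr_iff p c₀ _ rfl (Category.id_comp c₀)).1 (h.exhibits (hp.restr hc₀))

theorem IsCocompletion.mem_saturation {Φ : WeightClass V} {A E : V} {j : A ⟶ E}
    (h : IsCocompletion Φ j) : LooseChain.single (conjoint j) ∈ saturation Φ E A := by
  -- `Φ` with the one weight `E(j, 1)` added. Weights are indexed by their end objects, hence the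
  -- transports.
  let Φ' : WeightClass V := fun X Y => {ps | ps ∈ Φ X Y ∨
    ∃ (hX : X = E) (hY : Y = A), ps = hX ▸ hY ▸ LooseChain.single (conjoint j)}
  have hle : ∀ {X Y : V} {ps : Weight X Y}, ps ∈ Φ X Y → ps ∈ Φ' X Y := Or.inl
  have hcoc : ∀ X : V, IsCocomplete Φ X → IsCocomplete Φ' X := by
    rintro X hX W D ps (hps | ⟨rfl, rfl, rfl⟩) f
    · exact hX ps hps f
    · obtain ⟨c, γ, hγ, -⟩ := h.tight f hX
      exact ⟨c, γ, hγ⟩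
  have hexact : ∀ {W X : V} (p : Loose W X), IsExact Φ p → IsExact Φ' p := by
    refine fun p hp => ⟨hcoc _ hp.1, ?_⟩
    rintro W D ps (hps | ⟨rfl, rfl, rfl⟩) f c γ hγ
    · exact hp.2 ps hps f c γ hγ
    · exact h.exhibits_of_isLeftExtension hp hγ
  refine ⟨Φ', ⟨⟨hcoc, fun g hg => ?_, hexact⟩, fun X hX W D ps hps => hX ps (hle hps),
    fun g hg => ⟨fun ps hps => hg.1 ps (hle hps), fun ps hps => hg.2 ps (hle hps)⟩,
    fun p hp => ⟨fun ps hps => hp.1 ps (hle hps), fun ps hps => hp.2 ps (hle hps)⟩⟩,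
    Or.inr ⟨rfl, rfl, rfl⟩⟩
  -- Cocontinuity needs no separate argument, being exactness of the conjoint.
  rw [isCocontinuous_iff_isExact_conjoint] at hg ⊢
  exact hexact _ hg

end Cocompletions
end VDC

theorem mainTheorem5 {V : Type u} [VDC.VirtualDoubleCategory.{u, v, w, z} V]
    [VDC.VirtualEquipment V] (Φ : VDC.WeightClass V) {A E : V} (j : A ⟶ E) :
    VDC.IsCocompletion Φ j ↔
      VDC.IsCocomplete Φ E ∧
      VDC.LooseChain.single (VDC.conjoint j) ∈ VDC.saturation Φ E A ∧
      (VDC.IsLifting (.single (VDC.conjoint j)) ∧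
        ∀ (X : V) (p : VDC.VirtualDoubleCategory.Loose X A)
          (l : VDC.VirtualDoubleCategory.Loose X E)
          (ϖ : VDC.Glob (.cons (VDC.conjoint j) (.single l)) p),
          VDC.IsRightLift (.single (VDC.conjoint j)) p l ϖ → VDC.IsExact Φ l) ∧
      (VDC.IsDense j ∧ VDC.IsFullyFaithful j) := by
  constructor
  · intro h
    refine ⟨h.cocomplete, h.mem_saturation, ⟨fun X q => ?_, fun X p l ϖ hϖ => ?_⟩, ?_, ?_⟩
    · obtain ⟨l, ϖ, hϖ, -⟩ := h.loose q
      exact ⟨l, ϖ, hϖ⟩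
    · exact h.isExact_of_isRightLift hϖ
    -- `E(1, 1)` respects every colimit in `E` by the very definition of a colimit, so it is exact.
    · exact (VDC.isDense_iff j).2 (h.exhibits (VDC.isExact_looseId h.cocomplete))
    · refine VDC.isFullyFaithful_of_lifts fun q => ?_
      obtain ⟨l, ϖ, hϖ, hε, -⟩ := h.loose q
      exact ⟨l, ϖ, hϖ, hε⟩
  · rintro ⟨h₁, h₂, ⟨h₃, h₄⟩, h₅, h₆⟩
    exact VDC.isCocompletion_of_conditions h₁ h₂ h₃ h₄ h₅ h₆
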